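/- Let $\mathcal Y$ be a finite set. For a real $\mathcal Y\times\mathcal Y$ matrix $L$ and $A\subseteq\mathcal Y$ let $L_A$ be the principal submatrix of $L$ indexed by $A$ (with $\det L_\emptyset=1$), and put $\mathcal P_L(A)=\det(L_A)/\det(L+I)$. Let $\mathcal A^+$ be a non-empty finite multiset of subsets of $\mathcal Y$ (the positive training samples) and let $\nu$ be a probability distribution on $2^{\mathcal Y}$ that does not depend on $L$ (a static negative distribution). The contrastive-estimation objective is $$\phi_{\mathrm{CE}}(L)=\frac1{|\mathcal A^+|}\sum_{A\in\mathcal A^+}\log\det(L_A)-\log\det(L+I)-\mathbb E_{A\sim\nu}\bigl[\log\mathcal P_L(A)\bigr].$$ Let $k>0$ be an integer with $k\ge|S|$ for all $S\in\mathcal A^+\cup\operatorname{supp}(\nu)$. Let $K$ be a closed and bounded set of positive semidefinite $\mathcal Y\times\mathcal Y$ matrices of rank $k$ (more generally, of rank at most $k$) such that * $\phi_{\mathrm{CE}}$ is defined on $K$, i.e. $\det(L_A)\neq0$ for all $L\in K$ and $A\in\mathcal A^+\cup\operatorname{supp}(\nu)$; * the metric projection onto $K$ is well defined near $K$: for some $r>0$,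 every matrix at Frobenius distance less than $r$ from $K$ has exactly one nearest point in $K$ (this holds for every convex $K$). Let $\eta_t>0$ be step sizes with $\sum_t\eta_t=\infty$ and $\sum_t\eta_t^2<\infty$, and let $p,q\ge1$. Run projected stochastic gradient ascent: start at some (possibly random) $L_0\in K$; at step $t$ draw, independently of the past, a minibatch $A_1^+,\dots,A_p^+,A_1^-,\dots,A_q^-$, in which each $A_j^+$ is uniformly distributed over $\mathcal A^+$ and each $A_j^-$ has law $\nu$; put $$G_t=\nabla_L\Bigl[\frac1p\sum_{j=1}^p\log\mathcal P_L(A_j^+)-\frac1q\sum_{j=1}^q\log\mathcal P_L(A_j^-)\Bigr]_{L=L_t},$$ and let $L_{t+1}$ be a nearest point of $K$ to $L_t+\eta_tG_t$ in the Frobenius norm. Call $L\in K$ a critical point of $\phi_{\mathrm{CE}}$ on $K$ if $\langle\nabla\phi_{\mathrm{CE}}(L),V\rangle\le0$ for every $V$ in the tangent (contingent) cone of $K$ at $L$, where $\langle\cdot,\cdot\rangle$ is the Frobenius inner product. Then, almost surely, $\phi_{\mathrm{CE}}(L_t)$ converges to a finite limit $c$, and $(L_t)$ converges to a non-empty, compact,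 connected set of critical points of $\phi_{\mathrm{CE}}$ on $K$ on which $\phi_{\mathrm{CE}}=c$, namely to the set of its limit points. In particular, if for every value the set of critical points of $\phi_{\mathrm{CE}}$ on $K$ with that value is totally disconnected (for example, if the critical points are isolated), then almost surely $(L_t)$ converges to a single critical point. -/

import Mathlib

open Filter Topology MeasureTheory ProbabilityTheory
open scoped NNReal ENNReal

noncomputable section

namespace DPP

variable {Y : Type*} [Fintype Y] [DecidableEq Y]

/-- The principal minor `det (L_A)`, where `L_A` is the submatrix of `L` indexed by `A`
(equal to `1` for `A = ∅`). -/
def minor (L : Matrix Y Y ℝ) (A : Finset Y) : ℝ :=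
  (L.submatrix (fun i : A => (i : Y)) (fun i : A => (i : Y))).det

/-- The determinantal probability `P_L(A) = det (L_A) / det (L + I)`. -/
def prob (L : Matrix Y Y ℝ) (A : Finset Y) : ℝ :=
  minor L A / (L + 1).det

/-- `φ_MLE(L) = (1 / |A⁺|) ∑_{A ∈ A⁺} log det (L_A) - log det (L + I)`; the training set `A⁺` is
a list of samples up to order, so it is a multiset. -/
def phiMLE (pos : Multiset (Finset Y)) (L : Matrix Y Y ℝ) : ℝ :=
  (pos.map fun A => Real.log (minor L A)).sum / (Multiset.card pos : ℝ) - Real.log (L + 1).det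

/-- The contrastive-estimation objective
`φ_CE(L) = φ_MLE(L) - E_{A ∼ ν} [log P_L(A)]`. -/
def phiCE (pos : Multiset (Finset Y)) (ν : PMF (Finset Y)) (L : Matrix Y Y ℝ) : ℝ :=
  phiMLE pos L - ∑ A : Finset Y, (ν A).toReal * Real.log (prob L A)

/-- The sample approximation of the contrastive-estimation objective given by a minibatch of
`p` positive and `q` negative samples:
`(1 / p) ∑ⱼ log P_L(Aⱼ⁺) - (1 / q) ∑ⱼ log P_L(Aⱼ⁻)`. -/
def phiBatch {p q : ℕ} (b : (Fin p → Finset Y) × (Fin q → Finset Y)) (L : Matrix Y Y ℝ) : ℝ :=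
  (∑ j, Real.log (prob L (b.1 j))) / (p : ℝ) - (∑ j, Real.log (prob L (b.2 j))) / (q : ℝ)

/-- The gradient of a function of a matrix: the matrix of its partial derivatives. -/
def grad (f : Matrix Y Y ℝ → ℝ) (L : Matrix Y Y ℝ) : Matrix Y Y ℝ :=
  Matrix.of fun i j => lineDeriv ℝ f L (Matrix.single i j 1)

/-- The Frobenius inner product `tr (Gᵀ V)`. -/
def frobInner (G V : Matrix Y Y ℝ) : ℝ := (G.transpose * V).trace

/-- The Frobenius norm. -/
def frobNorm (V : Matrix Y Y ℝ) : ℝ := √(frobInner V V)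

/-- `X` is a nearest point of `K` to `Z` in the Frobenius norm (a metric projection of `Z`
onto `K`). -/
def IsNearest (K : Set (Matrix Y Y ℝ)) (Z X : Matrix Y Y ℝ) : Prop :=
  X ∈ K ∧ ∀ W ∈ K, frobNorm (Z - X) ≤ frobNorm (Z - W)

/-- The metric projection onto `K` is well defined near `K`: for some `r > 0`, every matrix at
distance less than `r` from `K` has exactly one nearest point in `K`. For closed `K` this says
that `K` has positive reach. -/
def ProjectionWellDefinedNear (K : Set (Matrix Y Y ℝ)) : Prop :=
  ∃ r : ℝ, 0 < r ∧ ∀ Z : Matrix Y Y ℝ, (∃ W ∈ K, frobNorm (Z - W) < r) → ∃! X, IsNearest K Z X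

/-- `L` is a critical point of the maximization of `f` over `K`: no direction of the
(Bouligand) tangent cone of `K` at `L` is an ascent direction to first order. -/
def IsCriticalOn (f : Matrix Y Y ℝ → ℝ) (K : Set (Matrix Y Y ℝ)) (L : Matrix Y Y ℝ) : Prop :=
  L ∈ K ∧ ∀ V ∈ tangentConeAt ℝ≥0 K L, frobInner (grad f L) V ≤ 0

/-- The set of limit points of a sequence of matrices. -/
def limitPoints (u : ℕ → Matrix Y Y ℝ) : Set (Matrix Y Y ℝ) := {X | MapClusterPt X atTop u}

/-- A run of projected stochastic gradient ascent on `φ_CE` over the set `K`, with step sizes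
`η`, minibatches of `p` positive and `q` negative samples, iterates `L t`, and history `ℱ t`
before step `t`. -/
structure IsProjectedSGA {Ω : Type*} [mΩ : MeasurableSpace Ω] (μ : Measure Ω)
    (ℱ : Filtration ℕ mΩ)
    (pos : Multiset (Finset Y)) (hpos : pos ≠ 0) (ν : PMF (Finset Y))
    (K : Set (Matrix Y Y ℝ)) (η : ℕ → ℝ) {p q : ℕ}
    (batch : ℕ → Ω → (Fin p → Finset Y) × (Fin q → Finset Y))
    (L : ℕ → Ω → Matrix Y Y ℝ) : Prop where
  /-- The initial kernel lies in `K`. -/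
  init : ∀ ω, L 0 ω ∈ K
  /-- The kernel estimate before step `t` belongs to the history before step `t`. -/
  adapted : ∀ t i j, Measurable[ℱ t] fun ω => L t ω i j
  /-- The minibatch of step `t` belongs to the history after step `t`. -/
  batch_measurable : ∀ t, Measurable[ℱ (t + 1), ⊤] (batch t)
  /-- The minibatch of step `t` is drawn independently of the history before step `t`. -/
  batch_indep : ∀ t, Indep (MeasurableSpace.comap (batch t) ⊤) (ℱ t) μ
  /-- Every positive sample is uniformly distributed over the training set. -/
  law_pos : ∀ t j A, μ {ω | (batch t ω).1 j = A} = PMF.ofMultiset pos hpos A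
  /-- Every negative sample has law `ν`. -/
  law_neg : ∀ t j A, μ {ω | (batch t ω).2 j = A} = ν A
  /-- The ascent step along the stochastic gradient, followed by projection onto `K`. -/
  step : ∀ t ω,
    IsNearest K (L t ω + η t • grad (phiBatch (batch t ω)) (L t ω)) (L (t + 1) ω)

end DPP

end

/-! Neither `K` is convex nor the objective f concave, so f need not grow in conditional mean along
the run. The Lyapunov function is instead the Moreau envelope W(x) = max over w in K of f(w) - a‖x -
w‖², with a large constant a.

Two estimates make it work. Positive reach: projecting y onto K barely increases the distance to the
points of K (`IsNearestPoint.norm_sub_sq_le`, via Federer's `IsNearestPoint.le_norm_of_unique`);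
over a gradient step of size η the error is O(η)‖x - w‖² + O(η²). Smoothness: f(w) ≤ f(x) + ⟨∇f(x),
w - x⟩ + l‖w - x‖² uniformly on the compact set K × K (`IsCompact.exists_quadratic_bound`). Testing
W at the new iterate against the maximizer w belonging to the old one gives E[W(x_{t+1}) | past] ≥
W(x_t) + 2aη_t (W - f)(x_t) - O(η_t²).

By submartingale convergence W(x_t) converges and the sum of η_t (W - f)(x_t) is finite
(`ae_tendsto_and_summable_of_le_condExp`). The gap W - f ≥ 0 changes by O(η_t) per step and the η_t
have infinite sum, so the gap tends to 0 (`tendsto_zero_of_summable_mul`) and f(x_t) has the limit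
of W(x_t). At a limit point z the gap vanishes: f(w) ≤ f(z) + a‖w - z‖² on K, which forces
criticality. Since the steps tend to 0, the limit set is connected.

The determinantal model enters only through this: the log-probabilities are smooth near K, and a
minibatch gradient is a finite combination of their gradients whose bounded random weights are
independent of the past and have the weights of the objective as means. The stochastic gradient is
therefore bounded and unbiased. -/

set_option linter.unusedSectionVars false

/-! ### Nearest points and sets of positive reach. -/

section Reach

variable {E : Type*} [NormedAddCommGroup E]

/-- `p` is a nearest point of `K` to `z`. -/
def IsNearestPoint (K : Set E) (z p : E) : Prop :=
  p ∈ K ∧ ∀ w ∈ K, ‖z - p‖ ≤ ‖z - w‖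

theorem IsNearestPoint.infDist_eq {K : Set E} {z p : E} (h : IsNearestPoint K z p) :
    Metric.infDist z K = ‖z - p‖ := by
  apply le_antisymm
  · rw [← dist_eq_norm]; exact Metric.infDist_le_dist_of_mem h.1
  · rw [Metric.le_infDist ⟨p, h.1⟩]
    intro w hw
    rw [dist_eq_norm]
    exact h.2 w hw

theorem IsCompact.exists_isNearestPoint {K : Set E} (hK : IsCompact K) (hne : K.Nonempty) (z : E) :
    ∃ p, IsNearestPoint K z p := by
  obtain ⟨p, hp, h⟩ := hK.exists_isMinOn hne (f := fun w => ‖z - w‖) (by fun_prop)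
  exact ⟨p, hp, fun w hw => h hw⟩

variable [InnerProductSpace ℝ E]

/-- The distance to `K` increases at unit rate in the direction away from a unique nearest
point. -/
theorem exists_infDist_add_smul_gt {K : Set E} (hK : IsCompact K) {z p : E}
    (hp : IsNearestPoint K z p) (huniq : ∀ q, IsNearestPoint K z q → q = p)
    (hd : 0 < ‖z - p‖) {c : ℝ} (hc : c < 1) {s : ℝ} (hs : 0 < s) :
    ∃ v : E, ‖v‖ < s ∧ ‖z - p‖ + c * ‖v‖ < Metric.infDist (z + v) K := by
  set d := ‖z - p‖ with hd'
  set u : E := d⁻¹ • (z - p) with hu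
  have hun : ‖u‖ = 1 := by
    rw [hu, norm_smul, norm_inv, Real.norm_of_nonneg hd.le, ← hd', inv_mul_cancel₀ hd.ne']
  -- Move from `z` along the outward unit vector `u` by steps `e n` tending to 0. If the distance
  -- grew at rate at most `c`, the nearest points `q n` would accumulate at a nearest point of `z`,
  -- that is at `p`, and the limit of `key` would read d ≤ c d.
  by_contra! hcon
  have hne : K.Nonempty := ⟨p, hp.1⟩
  set e : ℕ → ℝ := fun n => s / 2 / (n + 1) with he
  have he0 : Tendsto e atTop (𝓝 0) := by
    have := tendsto_one_div_add_atTop_nhds_zero_nat (𝕜 := ℝ)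
    simpa [he, div_eq_mul_inv] using this.const_mul (s / 2)
  have hepos : ∀ n, 0 < e n := fun n => by positivity
  have helt : ∀ n, e n < s := fun n => by
    rw [he]
    have : s / 2 / (n + 1) ≤ s / 2 := div_le_self (by linarith) (by
      have : (0 : ℝ) ≤ n := n.cast_nonneg
      linarith)
    simp only
    linarith
  choose q hq using fun n => hK.exists_isNearestPoint hne (z + e n • u)
  have hnorm : ∀ n, ‖e n • u‖ = e n := fun n => by
    rw [norm_smul, hun, mul_one, Real.norm_of_nonneg (hepos n).le]
  have key : ∀ n, inner ℝ u (z - q n) ≤ c * d + c ^ 2 * e n := fun n => by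
    have h1 := hcon (e n • u) (by rw [hnorm]; exact helt n)
    rw [(hq n).infDist_eq, hnorm] at h1
    have h2 : ‖z + e n • u - q n‖ ^ 2 = ‖z - q n‖ ^ 2 + 2 * (e n * inner ℝ u (z - q n)) + e n ^ 2 := by
      rw [show z + e n • u - q n = (z - q n) + e n • u by abel, norm_add_sq_real, hnorm,
        inner_smul_right, real_inner_comm]
    have h3 : d ≤ ‖z - q n‖ := hp.2 _ (hq n).1
    have h4 : ‖z + e n • u - q n‖ ^ 2 ≤ (d + c * e n) ^ 2 :=
      pow_le_pow_left₀ (norm_nonneg _) h1 2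
    have h5 : d ^ 2 ≤ ‖z - q n‖ ^ 2 := pow_le_pow_left₀ hd.le h3 2
    have h6 : e n * (2 * inner ℝ u (z - q n)) ≤ e n * (2 * (c * d) + c ^ 2 * e n) := by
      nlinarith [sq_nonneg (e n)]
    have h7 := le_of_mul_le_mul_left h6 (hepos n)
    nlinarith [hepos n, sq_nonneg c, mul_nonneg (sq_nonneg c) (hepos n).le]
  obtain ⟨a, haK, ψ, hψ, hlim⟩ := hK.tendsto_subseq (fun n => (hq n).1)
  have heψ : Tendsto (fun n => e (ψ n)) atTop (𝓝 0) := he0.comp hψ.tendsto_atTop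
  have ha : IsNearestPoint K z a := by
    refine ⟨haK, fun w hw => ?_⟩
    have l1 : Tendsto (fun n => ‖z + e (ψ n) • u - q (ψ n)‖) atTop (𝓝 ‖z + (0 : ℝ) • u - a‖) :=
      ((tendsto_const_nhds.add (heψ.smul_const u)).sub hlim).norm
    have l2 : Tendsto (fun n => ‖z + e (ψ n) • u - w‖) atTop (𝓝 ‖z + (0 : ℝ) • u - w‖) :=
      ((tendsto_const_nhds.add (heψ.smul_const u)).sub tendsto_const_nhds).norm
    simpa using le_of_tendsto_of_tendsto' l1 l2 fun n => (hq (ψ n)).2 w hw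
  have hap := huniq a ha
  have l3 : Tendsto (fun n => inner ℝ u (z - q (ψ n))) atTop (𝓝 (inner ℝ u (z - a))) :=
    tendsto_const_nhds.inner (tendsto_const_nhds.sub hlim)
  have l4 : Tendsto (fun n => c * d + c ^ 2 * e (ψ n)) atTop (𝓝 (c * d + c ^ 2 * 0)) :=
    tendsto_const_nhds.add (heψ.const_mul _)
  have h8 := le_of_tendsto_of_tendsto' l3 l4 fun n => key (ψ n)
  rw [hap, hu, inner_smul_left, real_inner_self_eq_norm_sq, ← hd'] at h8
  have h9 : d⁻¹ * d ^ 2 = d := by field_simp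
  simp only [map_inv₀, conj_trivial, h9] at h8
  nlinarith

/-- If nearest points are unique up to distance `r` from `K`, then a nearest point stays nearest
along its normal ray up to distance `r` (Federer). -/
theorem IsNearestPoint.le_norm_of_unique [ProperSpace E] {K : Set E} (hK : IsCompact K) {r : ℝ}
    (hr : ∀ z, (∃ w ∈ K, ‖z - w‖ < r) → ∃! p, IsNearestPoint K z p)
    {y p : E} (hp : IsNearestPoint K y p) (h0 : 0 < ‖y - p‖) {ρ : ℝ} (h1 : ‖y - p‖ ≤ ρ)
    (h2 : ρ < r) {w : E} (hw : w ∈ K) : ρ ≤ ‖p + (ρ / ‖y - p‖) • (y - p) - w‖ := by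
  set τ := ‖y - p‖ with hτ
  set s := ρ - τ with hs
  have hs0 : 0 ≤ s := by linarith
  have hne : K.Nonempty := ⟨p, hp.1⟩
  have hcomp : IsCompact (Metric.closedBall y s) := isCompact_closedBall y s
  have hbne : (Metric.closedBall y s).Nonempty := ⟨y, Metric.mem_closedBall_self hs0⟩
  have hcont : Continuous fun z : E => Metric.infDist z K := Metric.continuous_infDist_pt K
  -- Maximize the distance to `K` penalized by c‖z - y‖. A maximizer inside the ball could be
  -- improved, since the distance can be increased there at a rate above `c`; so it lies on the
  -- sphere.
  have hslope : ∀ c : ℝ, 0 ≤ c → c < 1 → ∃ z ∈ Metric.closedBall y s,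
      τ + c * s ≤ Metric.infDist z K := by
    intro c hc0 hc1
    obtain ⟨z, hz, hmax⟩ := hcomp.exists_isMaxOn hbne
      (f := fun z => Metric.infDist z K - c * ‖z - y‖) (by fun_prop)
    have hzy : ‖z - y‖ ≤ s := by rwa [← dist_eq_norm]
    have hy := hmax (Metric.mem_closedBall_self hs0)
    simp only [Set.mem_ofPred_eq, hp.infDist_eq, sub_self, norm_zero, mul_zero, sub_zero] at hy
    rcases hzy.eq_or_lt with heq | hlt
    · exact ⟨z, hz, by rw [heq] at hy; linarith⟩
    exfalso
    obtain ⟨p0, hp0⟩ := hK.exists_isNearestPoint hne z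
    have hdz := hp0.infDist_eq
    have hle : ‖z - p0‖ ≤ ‖z - p‖ := hp0.2 p hp.1
    have hle' : ‖z - p‖ ≤ ‖z - y‖ + ‖y - p‖ := norm_sub_le_norm_sub_add_norm_sub z y p
    have hpos : 0 < ‖z - p0‖ := by
      rw [← hdz]; nlinarith [mul_nonneg hc0 (norm_nonneg (z - y))]
    obtain ⟨p1, hp1, hun⟩ := hr z ⟨p0, hp0.1, by linarith⟩
    have hu : ∀ q, IsNearestPoint K z q → q = p0 := fun q hq => by
      rw [hun q hq, hun p0 hp0]
    obtain ⟨v, hv, hgt⟩ := exists_infDist_add_smul_gt hK hp0 hu hpos hc1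
      (s := s - ‖z - y‖) (by linarith)
    have htri : ‖z + v - y‖ ≤ ‖z - y‖ + ‖v‖ := by
      rw [show z + v - y = z - y + v by abel]; exact norm_add_le _ _
    have hmem : z + v ∈ Metric.closedBall y s := by
      rw [Metric.mem_closedBall, dist_eq_norm]; linarith
    have := hmax hmem
    simp only [Set.mem_ofPred_eq] at this
    nlinarith [mul_le_mul_of_nonneg_left htri hc0]
  obtain ⟨z, hz, hmax⟩ := hcomp.exists_isMaxOn hbne hcont.continuousOn
  have hzd : τ + s ≤ Metric.infDist z K := by
    have l : Tendsto (fun n : ℕ => τ + (1 - 1 / ((n : ℝ) + 1)) * s) atTop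
        (𝓝 (τ + (1 - 0) * s)) :=
      tendsto_const_nhds.add ((tendsto_const_nhds.sub
        (tendsto_one_div_add_atTop_nhds_zero_nat (𝕜 := ℝ))).mul_const s)
    rw [sub_zero, one_mul] at l
    refine le_of_tendsto' l fun n => ?_
    have hn : (0 : ℝ) ≤ n := n.cast_nonneg
    obtain ⟨z', hz', h'⟩ := hslope (1 - 1 / ((n : ℝ) + 1))
      (by rw [sub_nonneg, div_le_one (by linarith)]; linarith)
      (by rw [sub_lt_self_iff]; positivity)
    exact h'.trans (hmax hz')
  have hzy : ‖z - y‖ ≤ s := by rwa [← dist_eq_norm]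
  have hzp : τ + s ≤ ‖z - p‖ := hzd.trans (by
    rw [← dist_eq_norm]; exact Metric.infDist_le_dist_of_mem hp.1)
  -- Since ‖z - p‖ ≥ τ + s while ‖z - y‖ ≤ s and ‖y - p‖ = τ, the triangle inequality is an
  -- equality, which puts `z` on the ray from `p` through `y`.
  have hin : s * τ ≤ inner ℝ (z - y) (y - p) := by
    have e1 : ‖z - p‖ ^ 2 = ‖z - y‖ ^ 2 + 2 * inner ℝ (z - y) (y - p) + τ ^ 2 := by
      rw [hτ, ← norm_add_sq_real, sub_add_sub_cancel]
    have e2 : (τ + s) ^ 2 ≤ ‖z - p‖ ^ 2 := pow_le_pow_left₀ (by linarith) hzp 2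
    have e3 : ‖z - y‖ ^ 2 ≤ s ^ 2 := pow_le_pow_left₀ (norm_nonneg _) hzy 2
    nlinarith
  have hray : (z - y) - (s / τ) • (y - p) = 0 := by
    have e1 : ‖(z - y) - (s / τ) • (y - p)‖ ^ 2 ≤ 0 := by
      rw [norm_sub_sq_real, inner_smul_right, norm_smul, mul_pow, ← hτ, Real.norm_eq_abs, sq_abs]
      have e2 : (s / τ) ^ 2 * τ ^ 2 = s ^ 2 := by field_simp
      have e3 : ‖z - y‖ ^ 2 ≤ s ^ 2 := pow_le_pow_left₀ (norm_nonneg _) hzy 2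
      have e4 : (s / τ) * (s * τ) ≤ (s / τ) * inner ℝ (z - y) (y - p) :=
        mul_le_mul_of_nonneg_left hin (by positivity)
      have e5 : (s / τ) * (s * τ) = s ^ 2 := by field_simp
      rw [e2]
      linarith
    simpa using le_antisymm e1 (by positivity)
  have hz' : p + (ρ / τ) • (y - p) = z := by
    have : ρ / τ = s / τ + 1 := by rw [hs]; field_simp; ring
    rw [this, add_smul, one_smul, ← sub_eq_zero.1 hray]
    abel
  rw [hz']
  have hwz := Metric.infDist_le_dist_of_mem (x := z) hw
  rw [dist_eq_norm] at hwz
  linarith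

/-- A nearest point of a set of positive reach is almost as close to the points of the set as the
projected point. -/
theorem IsNearestPoint.norm_sub_sq_le [ProperSpace E] {K : Set E} (hK : IsCompact K) {r R : ℝ}
    (hr : ∀ z, (∃ w ∈ K, ‖z - w‖ < r) → ∃! p, IsNearestPoint K z p) (hR : 0 < R) (hRr : R < r)
    {y p : E} (hp : IsNearestPoint K y p) {w : E} (hw : w ∈ K) :
    ‖p - w‖ ^ 2 ≤ ‖y - w‖ ^ 2 + ‖y - p‖ / R * ‖p - w‖ ^ 2 := by
  have e1 : ‖y - w‖ ^ 2 = ‖y - p‖ ^ 2 + 2 * inner ℝ (y - p) (p - w) + ‖p - w‖ ^ 2 := by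
    rw [← norm_add_sq_real, sub_add_sub_cancel]
  rcases (norm_nonneg (y - p)).eq_or_lt with h0 | h0
  · have : y - p = 0 := norm_eq_zero.1 h0.symm
    rw [e1, this]; simp
  rcases lt_or_ge ‖y - p‖ R with hlt | hge
  · have h1 := hp.le_norm_of_unique hK hr h0 hlt.le hRr hw
    have h2 : R ^ 2 ≤ ‖p + (R / ‖y - p‖) • (y - p) - w‖ ^ 2 := pow_le_pow_left₀ hR.le h1 2
    rw [show p + (R / ‖y - p‖) • (y - p) - w = (R / ‖y - p‖) • (y - p) + (p - w) by abel,
      norm_add_sq_real, inner_smul_left, norm_smul, Real.norm_of_nonneg (by positivity),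
      div_mul_cancel₀ _ h0.ne'] at h2
    simp only [conj_trivial] at h2
    have h3 : 0 ≤ ‖y - p‖ / R * (2 * (R / ‖y - p‖ * inner ℝ (y - p) (p - w)) + ‖p - w‖ ^ 2) :=
      mul_nonneg (by positivity) (by linarith)
    have h4 : ‖y - p‖ / R * (2 * (R / ‖y - p‖ * inner ℝ (y - p) (p - w)) + ‖p - w‖ ^ 2)
        = 2 * inner ℝ (y - p) (p - w) + ‖y - p‖ / R * ‖p - w‖ ^ 2 := by
      field_simp
    nlinarith [sq_nonneg ‖y - p‖]
  · have h1 : 1 ≤ ‖y - p‖ / R := (one_le_div hR).2 hge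
    nlinarith [sq_nonneg ‖p - w‖, sq_nonneg ‖y - w‖]

/-- One step of projected ascent from `x` with direction `G`. -/
theorem IsNearestPoint.norm_sub_sq_step_le [ProperSpace E] {K : Set E} (hK : IsCompact K)
    {r R : ℝ} (hr : ∀ z, (∃ w ∈ K, ‖z - w‖ < r) → ∃! p, IsNearestPoint K z p) (hR : 0 < R)
    (hRr : R < r) {x x' G : E} {η B H : ℝ} (hx : x ∈ K) (hη : 0 ≤ η) (hηH : η ≤ H)
    (hG : ‖G‖ ≤ B) (hp : IsNearestPoint K (x + η • G) x') {w : E} (hw : w ∈ K) :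
    ‖x' - w‖ ^ 2 ≤ ‖x - w‖ ^ 2 + 2 * η * inner ℝ G (x - w) + 2 * B / R * η * ‖x - w‖ ^ 2
      + (B ^ 2 + 8 * B ^ 3 * H / R) * η ^ 2 := by
  have hB : 0 ≤ B := (norm_nonneg _).trans hG
  have hn : ‖x + η • G - x'‖ ≤ η * B := by
    refine (hp.2 x hx).trans ?_
    rw [add_sub_cancel_left, norm_smul, Real.norm_of_nonneg hη]
    exact mul_le_mul_of_nonneg_left hG hη
  have hxx : ‖x' - x‖ ≤ 2 * (η * B) := by
    have : x' - x = η • G - (x + η • G - x') := by abel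
    rw [this]
    refine (norm_sub_le _ _).trans ?_
    have : ‖η • G‖ ≤ η * B := by
      rw [norm_smul, Real.norm_of_nonneg hη]; exact mul_le_mul_of_nonneg_left hG hη
    linarith
  have hxw : ‖x' - w‖ ^ 2 ≤ 2 * ‖x - w‖ ^ 2 + 8 * (η * B) ^ 2 := by
    have h1 : ‖x' - w‖ ≤ ‖x' - x‖ + ‖x - w‖ := norm_sub_le_norm_sub_add_norm_sub _ _ _
    have h2 : ‖x' - w‖ ^ 2 ≤ (2 * (η * B) + ‖x - w‖) ^ 2 :=
      pow_le_pow_left₀ (norm_nonneg _) (by linarith) 2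
    nlinarith [sq_nonneg (2 * (η * B) - ‖x - w‖)]
  have h1 := hp.norm_sub_sq_le hK hr hR hRr hw
  have h2 : ‖x + η • G - w‖ ^ 2 ≤ ‖x - w‖ ^ 2 + 2 * η * inner ℝ G (x - w) + B ^ 2 * η ^ 2 := by
    rw [show x + η • G - w = (x - w) + η • G by abel, norm_add_sq_real, inner_smul_right,
      real_inner_comm, norm_smul, mul_pow, Real.norm_of_nonneg hη]
    nlinarith [mul_le_mul_of_nonneg_left (pow_le_pow_left₀ (norm_nonneg _) hG 2) (sq_nonneg η)]
  have h3 : ‖x + η • G - x'‖ / R * ‖x' - w‖ ^ 2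
      ≤ η * B / R * (2 * ‖x - w‖ ^ 2 + 8 * (η * B) ^ 2) := by
    gcongr
  have h4 : η * B / R * (8 * (η * B) ^ 2) ≤ 8 * B ^ 3 * H / R * η ^ 2 := by
    -- One factor of the cubic term is traded for the bound `H`, leaving an error quadratic in `η`.
    have : η * B / R * (8 * (η * B) ^ 2) = 8 * B ^ 3 * η / R * η ^ 2 := by ring
    rw [this]
    gcongr
  have h5 : η * B / R * (2 * ‖x - w‖ ^ 2 + 8 * (η * B) ^ 2)
      = 2 * B / R * η * ‖x - w‖ ^ 2 + η * B / R * (8 * (η * B) ^ 2) := by ring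
  linarith

theorem IsNearestPoint.norm_step_le {K : Set E} {x x' G : E} {η B : ℝ} (hx : x ∈ K)
    (hη : 0 ≤ η) (hG : ‖G‖ ≤ B) (hp : IsNearestPoint K (x + η • G) x') :
    ‖x' - x‖ ≤ 2 * B * η := by
  have h1 : ‖η • G‖ ≤ η * B := by
    rw [norm_smul, Real.norm_of_nonneg hη]; exact mul_le_mul_of_nonneg_left hG hη
  have h2 : ‖x + η • G - x'‖ ≤ ‖η • G‖ := by simpa using hp.2 x hx
  have : x' - x = η • G - (x + η • G - x') := by abel
  rw [this]
  have := norm_sub_le (η • G) (x + η • G - x')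
  linarith

end Reach

/-! ### A deterministic lemma on weighted summable sequences. -/

/-- A nonnegative sequence with steps of size `O(η)` tends to zero if it is summable against the
non-summable weights `η`. -/
theorem tendsto_zero_of_summable_mul {η D : ℕ → ℝ} (hη : ∀ t, 0 < η t) (hη0 : Tendsto η atTop (𝓝 0))
    (hηsum : ¬ Summable η) (hD : ∀ t, 0 ≤ D t) (hsum : Summable fun t => η t * D t) {C : ℝ}
    (hC : ∀ t, D (t + 1) ≤ D t + C * η t) : Tendsto D atTop (𝓝 0) := by
  wlog hC0 : 0 < C generalizing C
  · exact this (C := 1) (fun t => (hC t).trans (by nlinarith [hη t])) one_pos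
  rw [Metric.tendsto_atTop]
  intro ε' hε'
  set ε := ε' / 4 with hε
  have hε0 : 0 < ε := by positivity
  obtain ⟨N, hN⟩ := (Metric.cauchySeq_iff.1 hsum.hasSum.tendsto_sum_nat.cauchySeq)
    (ε * ε / C) (by positivity)
  obtain ⟨N', hN'⟩ := Metric.tendsto_atTop.1 hη0 (ε / C) (by positivity)
  -- If `D` stayed above `ε`, then `η` would be dominated by ε⁻¹ η D and be summable.
  obtain ⟨n, hn, hDn⟩ : ∃ n, max N N' ≤ n ∧ D n ≤ ε := by
    by_contra! hcon
    apply hηsum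
    rw [← summable_nat_add_iff (max N N')]
    refine Summable.of_nonneg_of_le (fun t => (hη _).le) (fun t => ?_)
      (((summable_nat_add_iff (max N N')).2 hsum).mul_left ε⁻¹)
    have := hcon (t + max N N') (by omega)
    have h2 := hη (t + max N N')
    rw [inv_mul_eq_div, le_div_iff₀ hε0]
    exact mul_le_mul_of_nonneg_left this.le h2.le
  -- From a level at most `ε` one step reaches at most 2ε. Above `ε` the increment C η is at most
  -- (C/ε) η D, so it is charged to the tail of the series, and that total is at most `ε`.
  have key : ∀ m, n ≤ m → D m ≤ 2 * ε + C / ε *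
      (∑ t ∈ Finset.range m, η t * D t - ∑ t ∈ Finset.range n, η t * D t) := by
    intro m hm
    induction m, hm using Nat.le_induction with
    | base => simp; linarith
    | succ m hm ih =>
      rw [Finset.sum_range_succ]
      have hstep := hC m
      have hηm : C * η m < ε := by
        have := hN' m ((le_max_right _ _).trans (hn.trans hm))
        rw [Real.dist_0_eq_abs, abs_of_pos (hη m), lt_div_iff₀ hC0] at this
        linarith
      have hmono : 0 ≤ ∑ t ∈ Finset.range m, η t * D t - ∑ t ∈ Finset.range n, η t * D t := by
        rw [sub_nonneg]
        exact Finset.sum_le_sum_of_subset_of_nonneg (Finset.range_mono hm)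
          fun t _ _ => mul_nonneg (hη t).le (hD t)
      have hηD := mul_nonneg (hη m).le (hD m)
      rcases le_or_gt (D m) ε with h | h
      · have : 0 ≤ C / ε * (∑ t ∈ Finset.range m, η t * D t + η m * D m
          - ∑ t ∈ Finset.range n, η t * D t) := mul_nonneg (by positivity) (by linarith)
        linarith
      · have : C * η m ≤ C / ε * (η m * D m) := by
          rw [div_mul_eq_mul_div, le_div_iff₀ hε0, mul_assoc]
          exact mul_le_mul_of_nonneg_left (mul_le_mul_of_nonneg_left h.le (hη m).le) hC0.le
        nlinarith
  refine ⟨n, fun m hm => ?_⟩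
  rw [Real.dist_0_eq_abs, abs_of_nonneg (hD m)]
  have h1 := hN m ((le_max_left _ _).trans (hn.trans hm)) n ((le_max_left _ _).trans hn)
  rw [Real.dist_eq] at h1
  have h2 := (le_abs_self _).trans h1.le
  have h3 := mul_le_mul_of_nonneg_left h2 (show 0 ≤ C / ε by positivity)
  have h4 : C / ε * (ε * ε / C) = ε := by field_simp
  have := key m hm
  linarith

/-! ### Limit sets of sequences in a compact set. -/

section LimitSet

variable {X : Type*} [MetricSpace X]

/-- A subsequence avoiding a neighbourhood of the limit set would, by compactness, have a cluster
point, and that point belongs to the limit set. -/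
theorem IsCompact.tendsto_nhdsSet_mapClusterPt {K : Set X} (hK : IsCompact K) {u : ℕ → X}
    (hu : ∀ n, u n ∈ K) : Tendsto u atTop (𝓝ˢ {x | MapClusterPt x atTop u}) := by
  by_contra hcon
  rw [Filter.not_tendsto_iff_exists_frequently_notMem] at hcon
  obtain ⟨U, hU, hfr⟩ := hcon
  rw [mem_nhdsSet_iff_exists] at hU
  obtain ⟨V, hV, hsub, hVU⟩ := hU
  obtain ⟨ψ, hψ, hψV⟩ := extraction_of_frequently_atTop hfr
  obtain ⟨a, -, χ, hχ, hlim⟩ := hK.tendsto_subseq (fun n => hu (ψ n))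
  have hacl : MapClusterPt a atTop u :=
    (hlim.mapClusterPt).of_comp (hψ.tendsto_atTop.comp hχ.tendsto_atTop)
  have := hlim.eventually (hV.mem_nhds (hsub hacl))
  obtain ⟨n, hn⟩ := this.exists
  exact hψV _ (hVU hn)

theorem IsCompact.isCompact_mapClusterPt {K : Set X} (hK : IsCompact K) {u : ℕ → X}
    (hu : ∀ n, u n ∈ K) : IsCompact {x | MapClusterPt x atTop u} := by
  refine hK.of_isClosed_subset isClosed_setOfPred_clusterPt fun x hx => ?_
  exact hK.isClosed.mem_of_mapClusterPt hx (Eventually.of_forall hu)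

/-- The limit set of a sequence in a compact set whose steps tend to zero is connected. -/
theorem IsCompact.isConnected_mapClusterPt {K : Set X} (hK : IsCompact K) {u : ℕ → X}
    (hu : ∀ n, u n ∈ K) (hstep : Tendsto (fun n => dist (u (n + 1)) (u n)) atTop (𝓝 0)) :
    IsConnected {x | MapClusterPt x atTop u} := by
  obtain ⟨a, -, ha⟩ := hK.exists_mapClusterPt (f := atTop) (u := u)
    (tendsto_principal.2 (Eventually.of_forall hu))
  refine ⟨⟨a, ha⟩, ?_⟩
  have hcomp := hK.isCompact_mapClusterPt hu
  have htend := hK.tendsto_nhdsSet_mapClusterPt hu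
  set Λ := {x | MapClusterPt x atTop u} with hΛ
  rw [isPreconnected_closed_iff]
  intro A B hA hB hAB hmA hmB
  by_contra hcon
  -- The two pieces have disjoint δ-thickenings. Late iterates lie in the δ/2-thickenings and move
  -- by less than δ/2, so they cannot change sides, although each side is visited infinitely often.
  have hdisj : Disjoint (Λ ∩ A) (Λ ∩ B) := by
    rw [Set.disjoint_left]
    exact fun x hxA hxB => hcon ⟨x, hxA.1, hxA.2, hxB.2⟩
  obtain ⟨δ, hδ, hth⟩ := hdisj.exists_thickenings (hcomp.inter_right hA)
    (hcomp.inter_right hB).isClosed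
  have hev : ∀ᶠ n in atTop, u n ∈ Metric.thickening (δ / 2) (Λ ∩ A) ∪
      Metric.thickening (δ / 2) (Λ ∩ B) := by
    refine htend.eventually (p := (· ∈ _)) ((IsOpen.mem_nhdsSet ?_).2 ?_)
    · exact Metric.isOpen_thickening.union Metric.isOpen_thickening
    · intro x hx
      rcases hAB hx with h | h
      · exact Or.inl (Metric.self_subset_thickening (by positivity) _ ⟨hx, h⟩)
      · exact Or.inr (Metric.self_subset_thickening (by positivity) _ ⟨hx, h⟩)
  have hst : ∀ᶠ n in atTop, dist (u (n + 1)) (u n) < δ / 2 :=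
    hstep.eventually_lt_const (by positivity)
  obtain ⟨N, hN⟩ := eventually_atTop.1 (hev.and hst)
  have hclose : ∀ S : Set X, ∀ n, N ≤ n → u n ∈ Metric.thickening (δ / 2) S →
      u (n + 1) ∈ Metric.thickening δ S := by
    intro S n hn hmem
    rw [Metric.mem_thickening_iff] at hmem ⊢
    obtain ⟨z, hz, hd⟩ := hmem
    refine ⟨z, hz, ?_⟩
    have h1 := (hN n hn).2
    have h2 := dist_triangle (u (n + 1)) (u n) z
    linarith
  have hmono : ∀ S : Set X, Metric.thickening (δ / 2) S ⊆ Metric.thickening δ S :=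
    fun S => Metric.thickening_mono (by linarith) S
  have hfreq : ∀ S : Set X, (Λ ∩ S).Nonempty →
      ∃ᶠ n in atTop, u n ∈ Metric.thickening (δ / 2) (Λ ∩ S) := by
    rintro S ⟨x, hx⟩
    exact MapClusterPt.frequently hx.1 (Metric.isOpen_thickening.mem_nhds
      (Metric.self_subset_thickening (by positivity) _ hx))
  obtain ⟨n, hn, hnA⟩ := frequently_atTop.1 (hfreq A hmA) N
  have hall : ∀ m, n ≤ m → u m ∈ Metric.thickening (δ / 2) (Λ ∩ A) := by
    intro m hm
    induction m, hm using Nat.le_induction with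
    | base => exact hnA
    | succ m hm ih =>
      rcases (hN (m + 1) (by omega)).1 with h | h
      · exact h
      · exact absurd (hmono _ h) (Set.disjoint_left.1 hth (hclose _ m (by omega) ih))
  obtain ⟨m, hm, hmB⟩ := frequently_atTop.1 (hfreq B hmB) n
  exact Set.disjoint_left.1 hth (hmono _ (hall m hm)) (hmono _ hmB)

end LimitSet

/-! ### A uniform second-order estimate. -/

/-- A function that is twice continuously differentiable at every point of a compact set satisfies
a uniform quadratic estimate there, whether or not the set is convex. -/
theorem IsCompact.exists_quadratic_bound {E : Type*} [NormedAddCommGroup E] [NormedSpace ℝ E]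
    {K : Set E} (hK : IsCompact K) {f : E → ℝ} (hf : ∀ x ∈ K, ContDiffAt ℝ 2 f x) :
    ∃ l : ℝ, ∀ x ∈ K, ∀ w ∈ K, f w ≤ f x + fderiv ℝ f x (w - x) + l * ‖w - x‖ ^ 2 := by
  suffices h : ∃ l : ℝ, ∀ z ∈ K ×ˢ K,
      f z.2 ≤ f z.1 + fderiv ℝ f z.1 (z.2 - z.1) + l * ‖z.2 - z.1‖ ^ 2 by
    obtain ⟨l, hl⟩ := h
    exact ⟨l, fun x hx w hw => hl (x, w) ⟨hx, hw⟩⟩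
  -- By compactness of the set of pairs, a bound near each pair suffices. Near the diagonal it is
  -- Taylor's estimate on a small ball, which is convex; away from it, the remainder divided by ‖w -
  -- x‖² is continuous, hence locally bounded.
  refine (hK.prod hK).induction_on (p := fun S => ∃ l : ℝ, ∀ z ∈ S,
      f z.2 ≤ f z.1 + fderiv ℝ f z.1 (z.2 - z.1) + l * ‖z.2 - z.1‖ ^ 2) ⟨0, by simp⟩ ?_ ?_ ?_
  · rintro s t hst ⟨l, hl⟩
    exact ⟨l, fun z hz => hl z (hst hz)⟩
  · rintro s t ⟨l, hl⟩ ⟨l', hl'⟩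
    refine ⟨max l l', fun z hz => ?_⟩
    rcases hz with hz | hz
    · exact (hl z hz).trans (by gcongr; exact le_max_left _ _)
    · exact (hl' z hz).trans (by gcongr; exact le_max_right _ _)
  rintro ⟨x, w⟩ ⟨hx, hw⟩
  rcases eq_or_ne w x with rfl | hne
  · obtain ⟨l, t, ht, hlip⟩ := ((hf w hx).fderiv_right (m := 1) (by norm_num)).exists_lipschitzOnWith
    have hdiff : ∀ᶠ y in 𝓝 w, DifferentiableAt ℝ f y :=
      ((hf w hx).eventually (by simp)).mono fun y hy => hy.differentiableAt (by simp)
    obtain ⟨ε, hε, hball⟩ := Metric.mem_nhds_iff.1 (inter_mem ht hdiff)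
    refine ⟨Metric.ball w ε ×ˢ Metric.ball w ε, mem_nhdsWithin_of_mem_nhds
      (prod_mem_nhds (Metric.ball_mem_nhds w hε) (Metric.ball_mem_nhds w hε)), l, ?_⟩
    rintro ⟨a, b⟩ ⟨ha, hb⟩
    have hseg : segment ℝ a b ⊆ Metric.ball w ε := (convex_ball w ε).segment_subset ha hb
    have := (convex_segment a b).norm_image_sub_le_of_norm_hasFDerivWithin_le'
      (f := f) (f' := fun y => fderiv ℝ f y) (φ := fderiv ℝ f a) (C := l * ‖b - a‖)
      (fun y hy => ((hball (hseg hy)).2).hasFDerivAt.hasFDerivWithinAt)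
      (fun y hy => by
        refine (hlip.norm_sub_le (hball (hseg hy)).1 (hball ha).1).trans ?_
        gcongr
        have := norm_sub_le_of_mem_segment hy
        exact this)
      (left_mem_segment ℝ a b) (right_mem_segment ℝ a b)
    have h2 := (le_abs_self _).trans this
    simp only
    rw [mul_assoc, ← sq] at h2
    linarith
  · have c1 : ContinuousAt (fun z : E × E => (f z.2 - f z.1 - fderiv ℝ f z.1 (z.2 - z.1)) /
        ‖z.2 - z.1‖ ^ 2) (x, w) := by
      have d1 : ContinuousAt (fun z : E × E => f z.2) (x, w) :=
        (hf w hw).continuousAt.comp_of_eq continuousAt_snd rfl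
      have d2 : ContinuousAt (fun z : E × E => f z.1) (x, w) :=
        (hf x hx).continuousAt.comp_of_eq continuousAt_fst rfl
      have d3 : ContinuousAt (fun z : E × E => fderiv ℝ f z.1) (x, w) :=
        ((hf x hx).fderiv_right (m := 1) (by norm_num)).continuousAt.comp_of_eq
          continuousAt_fst rfl
      refine ((d1.sub d2).sub (d3.clm_apply (by fun_prop))).div (by fun_prop) ?_
      simpa [sub_eq_zero] using hne
    set M := (f w - f x - fderiv ℝ f x (w - x)) / ‖w - x‖ ^ 2
    have h1 := c1.eventually_lt_const (show M < M + 1 by linarith)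
    have h2 : ∀ᶠ z : E × E in 𝓝 (x, w), z.2 ≠ z.1 :=
      (isOpen_ne_fun continuous_snd continuous_fst).mem_nhds hne
    refine ⟨_, mem_nhdsWithin_of_mem_nhds (h1.and h2), M + 1, ?_⟩
    rintro z ⟨hz1, hz2⟩
    have : 0 < ‖z.2 - z.1‖ ^ 2 := by
      have := norm_pos_iff.2 (sub_ne_zero.2 hz2)
      positivity
    rw [div_lt_iff₀ this] at hz1
    linarith

/-! ### Almost sure convergence of the process and of its drift. -/

/-- A bounded process that increases in conditional mean by a nonnegative drift, up to summable
deterministic errors, converges almost surely, and the drift is almost surely summable. -/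
theorem ae_tendsto_and_summable_of_le_condExp {Ω : Type*} {mΩ : MeasurableSpace Ω} {μ : Measure Ω}
    [IsProbabilityMeasure μ] {ℱ : Filtration ℕ mΩ} {W V : ℕ → Ω → ℝ} {ε : ℕ → ℝ} {M : ℝ}
    {M' : ℕ → ℝ} (hW : ∀ t, StronglyMeasurable[ℱ t] (W t)) (hV : ∀ t, StronglyMeasurable[ℱ t] (V t))
    (hWM : ∀ t ω, |W t ω| ≤ M) (hV0 : ∀ t ω, 0 ≤ V t ω) (hVM : ∀ t ω, V t ω ≤ M' t)
    (hε0 : ∀ t, 0 ≤ ε t) (hε : Summable ε)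
    (h : ∀ t, (fun ω => W t ω + V t ω - ε t) ≤ᵐ[μ] μ[W (t + 1) | ℱ t]) :
    ∀ᵐ ω ∂μ, (∃ c, Tendsto (fun t => W t ω) atTop (𝓝 c)) ∧ Summable fun t => V t ω := by
  set e : ℕ → ℝ := fun t => ∑ s ∈ Finset.range t, ε s with he
  set A : ℕ → Ω → ℝ := fun t ω => ∑ s ∈ Finset.range t, V s ω with hA
  set S : ℕ → Ω → ℝ := fun t ω => W t ω + (e t - A t ω) with hS
  -- `A t` sums the drift over s < t, so `A (t + 1)` is already known at time `t`; this
  -- predictability lets the compensator pass through the conditional expectation.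
  have hAmeas : ∀ t u, t ≤ u + 1 → StronglyMeasurable[ℱ u] (A t) := fun t u htu => by
    refine Finset.stronglyMeasurable_fun_sum _ fun s hs => (hV s).mono (ℱ.mono ?_)
    have := Finset.mem_range.1 hs
    omega
  have hA0 : ∀ t ω, 0 ≤ A t ω := fun t ω => Finset.sum_nonneg fun s _ => hV0 s ω
  have heT : ∀ t, e t ≤ ∑' s, ε s := fun t => hε.sum_le_tsum _ fun s _ => hε0 s
  have he0 : ∀ t, 0 ≤ e t := fun t => Finset.sum_nonneg fun s _ => hε0 s
  have hWint : ∀ t, Integrable (W t) μ := fun t =>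
    Integrable.of_bound ((hW t).mono (ℱ.le t)).aestronglyMeasurable M
      (Eventually.of_forall (hWM t))
  have hAint : ∀ t, Integrable (A t) μ := fun t =>
    Integrable.of_bound ((hAmeas t t (by omega)).mono (ℱ.le t)).aestronglyMeasurable
      (∑ s ∈ Finset.range t, M' s) (Eventually.of_forall fun ω => by
        rw [Real.norm_of_nonneg (hA0 t ω)]
        exact Finset.sum_le_sum fun s _ => hVM s ω)
  have hBint : ∀ t, Integrable (fun ω => e t - A t ω) μ := fun t =>
    (integrable_const _).sub (hAint t)
  have hsub : Submartingale S ℱ μ := by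
    refine submartingale_nat (fun t => (hW t).add
      (stronglyMeasurable_const.sub (hAmeas t t (by omega)))) (fun t => (hWint t).add (hBint t)) ?_
    intro t
    have h1 : μ[S (t + 1) | ℱ t] =ᵐ[μ]
        μ[W (t + 1) | ℱ t] + μ[fun ω => e (t + 1) - A (t + 1) ω | ℱ t] :=
      condExp_add (hWint _) (hBint _) _
    have h0 : StronglyMeasurable[ℱ t] fun ω => e (t + 1) - A (t + 1) ω :=
      stronglyMeasurable_const.sub (hAmeas (t + 1) t le_rfl)
    rw [condExp_of_stronglyMeasurable (ℱ.le t) h0 (hBint _)] at h1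
    filter_upwards [h1, h t] with ω h1 h2
    rw [h1]
    simp only [Pi.add_apply, hS, he, hA, Finset.sum_range_succ] at h2 ⊢
    linarith
  -- `S` is bounded above by b = M + ∑ε but not obviously below. Here |S| ≤ 2b - S, and the mean of
  -- `S t` is at least that of `S 0`, which is at least -M.
  have hbdd : ∀ t, eLpNorm (S t) 1 μ ≤ ((2 * (M + ∑' s, ε s) + M).toNNReal : ℝ≥0∞) := by
    intro t
    have hSint := hsub.integrable t
    rw [eLpNorm_one_eq_lintegral_enorm, ← ofReal_integral_norm_eq_lintegral_enorm hSint]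
    refine ENNReal.ofReal_le_ofReal ?_
    have h0 : -M ≤ ∫ ω, S t ω ∂μ := by
      have h1 := hsub.setIntegral_le (Nat.zero_le t) MeasurableSet.univ
      simp only [setIntegral_univ] at h1
      refine le_trans ?_ h1
      have : ∫ _ : Ω, -M ∂μ ≤ ∫ ω, S 0 ω ∂μ :=
        integral_mono (integrable_const _) (hsub.integrable 0) fun ω => by
          have := (abs_le.1 (hWM 0 ω)).1
          simpa [hS, he, hA] using this
      simpa using this
    have h2 : ∫ ω, ‖S t ω‖ ∂μ ≤ ∫ ω, (2 * (M + ∑' s, ε s) - S t ω) ∂μ := by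
      refine integral_mono hSint.norm ((integrable_const _).sub hSint) fun ω => ?_
      have h3 := abs_le.1 (hWM t ω)
      have h4 : S t ω ≤ M + ∑' s, ε s := by
        simp only [hS]
        linarith [h3.2, heT t, hA0 t ω]
      have h5 : 0 ≤ M := by linarith
      have h6 := (he0 t).trans (heT t)
      simp only [Real.norm_eq_abs]
      rw [abs_le']
      constructor <;> linarith
    rw [integral_sub (integrable_const _) hSint] at h2
    simp only [integral_const, probReal_univ, smul_eq_mul, one_mul] at h2
    linarith
  filter_upwards [hsub.exists_ae_tendsto_of_bdd hbdd] with ω hω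
  obtain ⟨c, hc⟩ := hω
  -- A convergent path of `S` is bounded below, which bounds the partial sums of `V` from above.
  have hsum : Summable fun t => V t ω := by
    obtain ⟨b, hb⟩ := hc.bddBelow_range
    refine summable_of_sum_range_le (c := M + ∑' s, ε s - b) (fun t => hV0 t ω) fun t => ?_
    have h1 := hb ⟨t, rfl⟩
    have h2 := (abs_le.1 (hWM t ω)).2
    have h3 := heT t
    simp only [hS, hA] at h1
    linarith
  refine ⟨⟨c - (∑' s, ε s - ∑' s, V s ω), ?_⟩, hsum⟩
  have := hc.sub (hε.hasSum.tendsto_sum_nat.sub hsum.hasSum.tendsto_sum_nat)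
  refine this.congr fun t => ?_
  simp [hS, he, hA]

/-! ### Projected stochastic ascent with the Moreau envelope as Lyapunov function. -/

/-- **Convergence of projected stochastic gradient ascent** on a compact set near which the metric
projection is well defined, for an objective with a quadratic upper estimate. -/
theorem ae_tendsto_projected_stochastic_ascent {E : Type*} [NormedAddCommGroup E]
    [InnerProductSpace ℝ E] [ProperSpace E] [MeasurableSpace E] [BorelSpace E] {K : Set E}
    (hK : IsCompact K) {r : ℝ} (hr0 : 0 < r)
    (hr : ∀ z, (∃ w ∈ K, ‖z - w‖ < r) → ∃! p, IsNearestPoint K z p) {f : E → ℝ} {g : E → E}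
    (hf : ContinuousOn f K) (hg : ContinuousOn g K) {l : ℝ}
    (hquad : ∀ x ∈ K, ∀ w ∈ K, f w ≤ f x + inner ℝ (g x) (w - x) + l * ‖w - x‖ ^ 2)
    {η : ℕ → ℝ} (hη : ∀ t, 0 < η t) (hηsum : ¬ Summable η) (hηsq : Summable fun t => η t ^ 2)
    {Ω : Type*} {mΩ : MeasurableSpace Ω} {μ : Measure Ω} [IsProbabilityMeasure μ]
    {ℱ : Filtration ℕ mΩ} {x G : ℕ → Ω → E} {B : ℝ} (hxK : ∀ t ω, x t ω ∈ K)
    (hx : ∀ t, Measurable[ℱ t] (x t)) (hG : ∀ᵐ ω ∂μ, ∀ t, ‖G t ω‖ ≤ B)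
    (hint : ∀ t, ∀ w ∈ K, Integrable (fun ω => inner ℝ (G t ω) (x t ω - w)) μ)
    (hmean : ∀ t, ∀ w ∈ K, μ[fun ω => inner ℝ (G t ω) (x t ω - w) | ℱ t] =ᵐ[μ]
      fun ω => inner ℝ (g (x t ω)) (x t ω - w))
    (hstep : ∀ t ω, IsNearestPoint K (x t ω + η t • G t ω) (x (t + 1) ω)) :
    ∃ a : ℝ, ∀ᵐ ω ∂μ, Tendsto (fun t => dist (x (t + 1) ω) (x t ω)) atTop (𝓝 0) ∧
      ∃ c, Tendsto (fun t => f (x t ω)) atTop (𝓝 c) ∧ ∀ z, MapClusterPt z atTop (fun t => x t ω) →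
        z ∈ K ∧ f z = c ∧ ∀ w ∈ K, f w ≤ f z + a * ‖w - z‖ ^ 2 := by
  have hη0 : Tendsto η atTop (𝓝 0) := by
    have := (Real.continuous_sqrt.tendsto _).comp hηsq.tendsto_atTop_zero
    simpa [Function.comp_def, Real.sqrt_sq (hη _).le] using this
  obtain ⟨H, hH⟩ := hη0.bddAbove_range
  replace hH : ∀ t, η t ≤ H := fun t => hH ⟨t, rfl⟩
  have hH0 : 0 < H := (hη 0).trans_le (hH 0)
  have hne : K.Nonempty := by
    obtain ⟨ω⟩ := nonempty_of_isProbabilityMeasure μ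
    exact ⟨_, hxK 0 ω⟩
  have hB : 0 ≤ B := by
    obtain ⟨ω, h⟩ := hG.exists
    exact (norm_nonneg _).trans (h 0)
  obtain ⟨Bf, hBf⟩ := hK.exists_bound_of_continuousOn hf
  obtain ⟨Bg, hBg⟩ := hK.exists_bound_of_continuousOn hg
  obtain ⟨d, hd⟩ := hK.isBounded.exists_norm_le
  have hd0 : 0 ≤ d := by
    obtain ⟨w, hw⟩ := hne
    exact (norm_nonneg w).trans (hd w hw)
  have hBg0 : 0 ≤ Bg := by
    obtain ⟨w, hw⟩ := hne
    exact (norm_nonneg _).trans (hBg w hw)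
  have hdd : ∀ u ∈ K, ∀ v ∈ K, ‖u - v‖ ≤ 2 * d := fun u hu v hv => by
    have := norm_sub_le u v
    linarith [hd u hu, hd v hv]
  set c1 : ℝ := 2 * B / (r / 2) with hc1
  set c2 : ℝ := B ^ 2 + 8 * B ^ 3 * H / (r / 2) with hc2
  have hc10 : 0 ≤ c1 := by positivity
  have hc20 : 0 ≤ c2 := by positivity
  -- Chosen so that 2a - 2l - c1 ≥ 0: the curvature of the penalty absorbs both the quadratic error
  -- of `f` and the reach error `c1` of the projection.
  set a : ℝ := |l| + c1 + 1 with ha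
  have ha0 : 0 < a := by positivity
  -- the Moreau envelope
  have hex : ∀ z : E, ∃ y ∈ K, ∀ w ∈ K, f w - a * ‖z - w‖ ^ 2 ≤ f y - a * ‖z - y‖ ^ 2 := fun z => by
    obtain ⟨y, hy, h⟩ := hK.exists_isMaxOn hne (f := fun w => f w - a * ‖z - w‖ ^ 2)
      (hf.sub (by fun_prop))
    exact ⟨y, hy, fun w hw => h hw⟩
  choose P hPK hP using hex
  set W : E → ℝ := fun z => f (P z) - a * ‖z - P z‖ ^ 2 with hWdef
  have hWf : ∀ z ∈ K, f z ≤ W z := fun z hz => by simpa using hP z z hz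
  have hfLip : ∀ u ∈ K, ∀ v ∈ K, f u ≤ f v + (Bg + |l| * (2 * d)) * ‖u - v‖ := fun u hu v hv => by
    have h1 := hquad v hv u hu
    have h2 : inner ℝ (g v) (u - v) ≤ Bg * ‖u - v‖ := (real_inner_le_norm _ _).trans
      (mul_le_mul_of_nonneg_right (hBg v hv) (norm_nonneg _))
    have h3 : l * ‖u - v‖ ^ 2 ≤ |l| * (2 * d) * ‖u - v‖ := by
      have e1 : l * ‖u - v‖ ^ 2 ≤ |l| * ‖u - v‖ ^ 2 :=
        mul_le_mul_of_nonneg_right (le_abs_self l) (sq_nonneg _)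
      have e2 : ‖u - v‖ ^ 2 ≤ 2 * d * ‖u - v‖ := by
        rw [sq]; exact mul_le_mul_of_nonneg_right (hdd u hu v hv) (norm_nonneg _)
      have e3 := mul_le_mul_of_nonneg_left e2 (abs_nonneg l)
      linarith
    linarith
  have hWLip : ∀ u ∈ K, ∀ v ∈ K, W u ≤ W v + a * (4 * d) * ‖u - v‖ := fun u hu v hv => by
    have h1 := hP v (P u) (hPK u)
    have h2 : ‖v - P u‖ ≤ ‖u - v‖ + ‖u - P u‖ := by
      rw [norm_sub_rev u v]; exact norm_sub_le_norm_sub_add_norm_sub _ _ _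
    have h3 : ‖v - P u‖ ^ 2 - ‖u - P u‖ ^ 2 ≤ 4 * d * ‖u - v‖ := by
      have e1 := hdd v hv (P u) (hPK u)
      have e2 := hdd u hu (P u) (hPK u)
      nlinarith [norm_nonneg (v - P u), norm_nonneg (u - P u), norm_nonneg (u - v)]
    have h4 := mul_le_mul_of_nonneg_left h3 ha0.le
    simp only [hWdef]
    linarith
  have hWcont : ContinuousOn W K := by
    refine (LipschitzOnWith.of_dist_le' (K := a * (4 * d))
      fun u hu v hv => ?_).continuousOn
    rw [Real.dist_eq, abs_le', dist_eq_norm]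
    constructor
    · have := hWLip u hu v hv
      linarith
    · have := hWLip v hv u hu
      rw [norm_sub_rev v u] at this
      linarith
  obtain ⟨BW, hBW⟩ := hK.exists_bound_of_continuousOn hWcont
  have hmeas : ∀ {h : E → ℝ}, ContinuousOn h K → ∀ t,
      StronglyMeasurable[ℱ t] fun ω => h (x t ω) := fun {h} hh t => by
    have h1 : Measurable[ℱ t] fun ω => (⟨x t ω, hxK t ω⟩ : K) := (hx t).subtype_mk
    exact ((continuousOn_iff_continuous_domRestrict.1 hh).measurable.comp h1).stronglyMeasurable
  have hbddint : ∀ {h : E → ℝ}, ContinuousOn h K → ∀ t, Integrable (fun ω => h (x t ω)) μ :=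
    fun {h} hh t => by
      obtain ⟨b, hb⟩ := hK.exists_bound_of_continuousOn hh
      exact Integrable.of_bound ((hmeas hh t).mono (ℱ.le t)).aestronglyMeasurable b
        (Eventually.of_forall fun ω => hb _ (hxK t ω))
  -- the conditional growth of the envelope, tested against a fixed competitor
  have hfix : ∀ t, ∀ w ∈ K, (fun ω => f w - a * ((1 + c1 * η t) * ‖x t ω - w‖ ^ 2
      + 2 * η t * inner ℝ (g (x t ω)) (x t ω - w) + c2 * η t ^ 2)) ≤ᵐ[μ]
        μ[fun ω => W (x (t + 1) ω) | ℱ t] := by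
    intro t w hw
    have hcn : ContinuousOn (fun z => f w - a * ((1 + c1 * η t) * ‖z - w‖ ^ 2 + c2 * η t ^ 2)) K := by
      fun_prop
    have hI1 := hbddint hcn t
    have hI2 : Integrable (fun ω => (-(2 * a * η t)) * inner ℝ (G t ω) (x t ω - w)) μ :=
      (hint t w hw).const_mul _
    have h1 : μ[(fun ω => f w - a * ((1 + c1 * η t) * ‖x t ω - w‖ ^ 2 + c2 * η t ^ 2)) +
        (fun ω => (-(2 * a * η t)) * inner ℝ (G t ω) (x t ω - w)) | ℱ t] ≤ᵐ[μ]
          μ[fun ω => W (x (t + 1) ω) | ℱ t] := by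
      refine condExp_mono (hI1.add hI2) (hbddint hWcont (t + 1)) ?_
      filter_upwards [hG] with ω hGω
      have e1 := hP (x (t + 1) ω) w hw
      have e2 := (hstep t ω).norm_sub_sq_step_le hK hr (R := r / 2) (by positivity) (by linarith)
        (hxK t ω) (hη t).le (hH t) (hGω t) hw
      have e3 := mul_le_mul_of_nonneg_left e2 ha0.le
      simp only [Pi.add_apply, hWdef]
      rw [← hc1, ← hc2] at e3
      linarith
    have h2 := condExp_add hI1 hI2 (ℱ t)
    have h3 := condExp_smul (μ := μ) (-(2 * a * η t)) (fun ω => inner ℝ (G t ω) (x t ω - w)) (ℱ t)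
    rw [condExp_of_stronglyMeasurable (ℱ.le t) (hmeas hcn t) hI1] at h2
    filter_upwards [h1, h2, h3, hmean t w hw] with ω h1 h2 h3 h4
    rw [h2, Pi.add_apply] at h1
    simp only [Pi.smul_apply, smul_eq_mul] at h3
    have h5 : (fun ω => (-(2 * a * η t)) * inner ℝ (G t ω) (x t ω - w)) =
        (-(2 * a * η t)) • (fun ω => inner ℝ (G t ω) (x t ω - w)) := rfl
    rw [h5, h3, h4] at h1
    linarith
  have hcond : ∀ t, (fun ω => W (x t ω) + 2 * a * (η t * (W (x t ω) - f (x t ω)))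
      - a * c2 * η t ^ 2) ≤ᵐ[μ] μ[fun ω => W (x (t + 1) ω) | ℱ t] := by
    intro t
    -- The competitor to insert is the random point `P (x t ω)`, and `P` is a mere choice with no
    -- measurability. The bound for fixed `w` is therefore made simultaneous on a countable dense
    -- set, extended to `K` by continuity in `w`, and only then evaluated pointwise.
    obtain ⟨D, hDK, hDc, hD⟩ := TopologicalSpace.IsSeparable.exists_countable_dense_subset
      hK.isSeparable
    have hall := (ae_ball_iff hDc).2 fun w hw => hfix t w (hDK hw)
    filter_upwards [hall] with ω hω
    have hall' : ∀ w ∈ K, f w - a * ((1 + c1 * η t) * ‖x t ω - w‖ ^ 2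
        + 2 * η t * inner ℝ (g (x t ω)) (x t ω - w) + c2 * η t ^ 2) ≤
          (μ[fun ω => W (x (t + 1) ω) | ℱ t]) ω := by
      intro w hw
      have hcn : ContinuousOn (fun w => f w - a * ((1 + c1 * η t) * ‖x t ω - w‖ ^ 2
        + 2 * η t * inner ℝ (g (x t ω)) (x t ω - w) + c2 * η t ^ 2)) K :=
        hf.sub (Continuous.continuousOn (by fun_prop))
      have hcl : w ∈ closure D := hD hw
      obtain ⟨v, hvD, hv⟩ := mem_closure_iff_seq_limit.1 hcl
      have := (hcn w hw).tendsto.comp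
        (tendsto_nhdsWithin_iff.2 ⟨hv, Eventually.of_forall fun n => hDK (hvD n)⟩)
      exact le_of_tendsto' this fun n => hω _ (hvD n)
    refine le_trans ?_ (hall' (P (x t ω)) (hPK _))
    have h1 := hquad (x t ω) (hxK t ω) (P (x t ω)) (hPK _)
    set X := x t ω
    have h2 : inner ℝ (g X) (P X - X) = - inner ℝ (g X) (X - P X) := by
      rw [← inner_neg_right, neg_sub]
    rw [h2, norm_sub_rev] at h1
    have h3 : 0 ≤ (2 * a - 2 * l - c1) * ‖X - P X‖ ^ 2 := by
      refine mul_nonneg ?_ (sq_nonneg _)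
      have := le_abs_self l
      have := abs_nonneg l
      linarith
    have h4 : 0 ≤ a * η t * (2 * (f X + - inner ℝ (g X) (X - P X) + l * ‖X - P X‖ ^ 2 - f (P X))
        + (2 * a - 2 * l - c1) * ‖X - P X‖ ^ 2) :=
      mul_nonneg (mul_nonneg ha0.le (hη t).le) (by linarith)
    simp only [hWdef]
    linarith
  refine ⟨a, ?_⟩
  have hgap : ContinuousOn (fun z => W z - f z) K := hWcont.sub hf
  have hmain := ae_tendsto_and_summable_of_le_condExp (μ := μ) (ℱ := ℱ)
    (W := fun t ω => W (x t ω)) (V := fun t ω => 2 * a * (η t * (W (x t ω) - f (x t ω))))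
    (ε := fun t => a * c2 * η t ^ 2) (M := BW) (M' := fun t => 2 * a * (η t * (BW + Bf)))
    (fun t => hmeas hWcont t)
    (fun t => hmeas (h := fun z => 2 * a * (η t * (W z - f z))) (by fun_prop) t)
    (fun t ω => hBW _ (hxK t ω))
    (fun t ω => mul_nonneg (by positivity)
      (mul_nonneg (hη t).le (sub_nonneg.2 (hWf _ (hxK t ω)))))
    (fun t ω => by
      have h1 := (abs_le.1 (hBW _ (hxK t ω))).2
      have h2 := (abs_le.1 (hBf _ (hxK t ω))).1
      have h3 := (hη t).le
      gcongr
      linarith)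
    (fun t => by positivity) (hηsq.mul_left _) hcond
  filter_upwards [hmain, hG] with ω hω hGω
  obtain ⟨⟨c, hc⟩, hsum⟩ := hω
  have hdist : ∀ t, ‖x (t + 1) ω - x t ω‖ ≤ 2 * B * η t := fun t =>
    (hstep t ω).norm_step_le (hxK t ω) (hη t).le (hGω t)
  have hsum' : Summable fun t => η t * (W (x t ω) - f (x t ω)) :=
    (summable_mul_left_iff (by positivity)).1 hsum
  have hgap0 : Tendsto (fun t => W (x t ω) - f (x t ω)) atTop (𝓝 0) := by
    refine tendsto_zero_of_summable_mul hη hη0 hηsum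
      (fun t => sub_nonneg.2 (hWf _ (hxK t ω))) hsum'
      (C := (a * (4 * d) + (Bg + |l| * (2 * d))) * (2 * B)) fun t => ?_
    have h1 := hWLip _ (hxK (t + 1) ω) _ (hxK t ω)
    have h2 := hfLip _ (hxK t ω) _ (hxK (t + 1) ω)
    rw [norm_sub_rev] at h2
    have h3 := mul_le_mul_of_nonneg_left (hdist t)
      (show 0 ≤ a * (4 * d) + (Bg + |l| * (2 * d)) by positivity)
    linarith
  have hfc : Tendsto (fun t => f (x t ω)) atTop (𝓝 c) := by
    simpa using hc.sub hgap0
  refine ⟨?_, c, hfc, fun z hz => ?_⟩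
  · refine squeeze_zero (fun _ => dist_nonneg) (fun t => ?_) (by simpa using hη0.const_mul (2 * B))
    rw [dist_eq_norm]; exact hdist t
  have hzK : z ∈ K := hK.isClosed.mem_of_mapClusterPt hz (Eventually.of_forall fun t => hxK t ω)
  obtain ⟨ψ, hψ, hlim⟩ := hz.tendsto_subseq
  have hlimK : Tendsto (fun n => x (ψ n) ω) atTop (𝓝[K] z) :=
    tendsto_nhdsWithin_iff.2 ⟨hlim, Eventually.of_forall fun n => hxK _ ω⟩
  have hfz : f z = c := tendsto_nhds_unique ((hf z hzK).tendsto.comp hlimK)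
    (hfc.comp hψ.tendsto_atTop)
  have hWz : W z - f z = 0 := tendsto_nhds_unique ((hgap z hzK).tendsto.comp hlimK)
    (hgap0.comp hψ.tendsto_atTop)
  refine ⟨hzK, hfz, fun w hw => ?_⟩
  have := hP z w hw
  rw [norm_sub_rev w z]
  simp only [hWdef] at hWz
  linarith

/-- Conditional mean of a combination of independent bounded weights with bounded coefficients
that are known. -/
theorem integrable_and_condExp_sum_mul_of_indep {Ω ι : Type*} {m₁ m₂ mΩ : MeasurableSpace Ω}
    {μ : Measure Ω} [IsProbabilityMeasure μ] (h₁ : m₁ ≤ mΩ) (h₂ : m₂ ≤ mΩ) (hind : Indep m₁ m₂ μ)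
    (s : Finset ι) {N H : ι → Ω → ℝ} {b c : ι → ℝ} (hN : ∀ i ∈ s, StronglyMeasurable[m₁] (N i))
    (hH : ∀ i ∈ s, StronglyMeasurable[m₂] (H i)) (hNb : ∀ i ∈ s, ∀ ω, |N i ω| ≤ b i)
    (hHc : ∀ i ∈ s, ∀ ω, |H i ω| ≤ c i) :
    Integrable (fun ω => ∑ i ∈ s, N i ω * H i ω) μ ∧
      μ[fun ω => ∑ i ∈ s, N i ω * H i ω | m₂] =ᵐ[μ]
        fun ω => ∑ i ∈ s, (∫ ω', N i ω' ∂μ) * H i ω := by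
  have hNint : ∀ i ∈ s, Integrable (N i) μ := fun i hi =>
    Integrable.of_bound ((hN i hi).mono h₁).aestronglyMeasurable (b i)
      (Eventually.of_forall (hNb i hi))
  have hint : ∀ i ∈ s, Integrable (N i * H i) μ := fun i hi =>
    (hNint i hi).mul_bdd (c := c i) ((hH i hi).mono h₂).aestronglyMeasurable
      (Eventually.of_forall (hHc i hi))
  have hsum : (fun ω => ∑ i ∈ s, N i ω * H i ω) = ∑ i ∈ s, N i * H i := by
    ext ω; simp
  refine ⟨integrable_finsetSum s hint, ?_⟩
  rw [hsum]
  have hall : ∀ᵐ ω ∂μ, ∀ i ∈ s, (μ[N i * H i | m₂]) ω = (∫ ω', N i ω' ∂μ) * H i ω := by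
    rw [Filter.eventually_all_finset]
    intro i hi
    filter_upwards [condExp_mul_of_stronglyMeasurable_right (hH i hi) (hint i hi) (hNint i hi),
      condExp_indep_eq h₁ h₂ (hN i hi) hind] with ω e1 e2
    rw [e1, Pi.mul_apply, e2]
  filter_upwards [condExp_finsetSum hint m₂, hall] with ω e1 e2
  rw [e1, Finset.sum_apply]
  exact Finset.sum_congr rfl fun i hi => e2 i hi


/-! ### Frobenius geometry and smoothness of the log-probabilities. -/

namespace DPP

variable {Y : Type*} [Fintype Y] [DecidableEq Y]

theorem frobInner_eq_sum (G V : Matrix Y Y ℝ) : frobInner G V = ∑ i, ∑ j, G i j * V i j := by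
  simp only [frobInner, Matrix.trace, Matrix.diag_apply, Matrix.mul_apply, Matrix.transpose_apply]
  exact Finset.sum_comm

section Frobenius

attribute [local instance] Matrix.frobeniusNormedAddCommGroup Matrix.frobeniusNormedSpace

theorem frobenius_norm_sq (V : Matrix Y Y ℝ) : ‖V‖ ^ 2 = frobInner V V := by
  rw [Matrix.frobenius_norm_def, ← Real.sqrt_eq_rpow, Real.sq_sqrt (by positivity),
    frobInner_eq_sum]
  simp [sq]

/-- The Frobenius inner product space structure on matrices. -/
@[reducible] noncomputable def frobeniusInnerProductSpace : InnerProductSpace ℝ (Matrix Y Y ℝ) where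
  inner := frobInner
  norm_sq_eq_re_inner V := frobenius_norm_sq V
  conj_inner_symm G V := by
    simp only [frobInner_eq_sum, conj_trivial]
    simp only [mul_comm]
  add_left G G' V := by simp [frobInner_eq_sum, add_mul, Finset.sum_add_distrib]
  smul_left G V c := by simp [frobInner_eq_sum, Finset.mul_sum, mul_assoc]

attribute [local instance] frobeniusInnerProductSpace

theorem frobNorm_eq_norm (V : Matrix Y Y ℝ) : frobNorm V = ‖V‖ := by
  rw [frobNorm, ← frobenius_norm_sq, Real.sqrt_sq (norm_nonneg _)]

theorem isNearest_iff {K : Set (Matrix Y Y ℝ)} {Z X : Matrix Y Y ℝ} :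
    IsNearest K Z X ↔ IsNearestPoint K Z X := by
  simp only [IsNearest, IsNearestPoint, frobNorm_eq_norm]

theorem grad_apply {f : Matrix Y Y ℝ → ℝ} {L : Matrix Y Y ℝ} (hf : DifferentiableAt ℝ f L)
    (i j : Y) : grad f L i j = fderiv ℝ f L (Matrix.single i j 1) :=
  hf.lineDeriv_eq_fderiv

theorem inner_grad {f : Matrix Y Y ℝ → ℝ} {L : Matrix Y Y ℝ} (hf : DifferentiableAt ℝ f L)
    (V : Matrix Y Y ℝ) : inner ℝ (grad f L) V = fderiv ℝ f L V := by
  have h : ∀ i j, Matrix.single i j (V i j) = V i j • Matrix.single i j (1 : ℝ) := fun i j => by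
    rw [Matrix.smul_single, smul_eq_mul, mul_one]
  have : inner ℝ (grad f L) V = ∑ i, ∑ j, grad f L i j * V i j := frobInner_eq_sum _ _
  rw [this]
  conv_rhs => rw [Matrix.matrix_eq_sum_single V]
  simp only [h, map_sum, map_smul, grad_apply hf, smul_eq_mul, mul_comm]

theorem continuousOn_grad {f : Matrix Y Y ℝ → ℝ} {K : Set (Matrix Y Y ℝ)}
    (hf : ∀ L ∈ K, ContDiffAt ℝ 2 f L) : ContinuousOn (grad f) K := by
  have h : ContinuousOn (fun L i j => grad f L i j) K := by
    refine continuousOn_pi.2 fun i => continuousOn_pi.2 fun j => ?_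
    have h1 : ContinuousOn (fun L => fderiv ℝ f L (Matrix.single i j 1)) K := fun L hL =>
      (((hf L hL).fderiv_right (m := 1) (by norm_num)).continuousAt.clm_apply
        continuousAt_const).continuousWithinAt
    exact h1.congr fun L hL => grad_apply ((hf L hL).differentiableAt (by simp)) i j
  exact h

theorem grad_sum_mul {ι : Type*} (s : Finset ι) {c : ι → ℝ} {h : ι → Matrix Y Y ℝ → ℝ}
    {L : Matrix Y Y ℝ} (hh : ∀ i ∈ s, DifferentiableAt ℝ (h i) L) :
    grad (fun X => ∑ i ∈ s, c i * h i X) L = ∑ i ∈ s, c i • grad (h i) L := by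
  have hd : HasFDerivAt (fun X => ∑ i ∈ s, c i * h i X) (∑ i ∈ s, c i • fderiv ℝ (h i) L) L :=
    HasFDerivAt.fun_sum fun i hi => (hh i hi).hasFDerivAt.const_mul (c i)
  ext k l
  rw [grad_apply hd.differentiableAt, hd.fderiv, Matrix.sum_apply, _root_.sum_apply]
  exact Finset.sum_congr rfl fun i hi => by
    rw [Matrix.smul_apply, grad_apply (hh i hi)]; rfl

theorem contDiff_det_comp {ι : Type*} [Fintype ι] [DecidableEq ι] {n : ℕ∞}
    {M : Matrix Y Y ℝ → Matrix ι ι ℝ} (hM : ∀ i j, ContDiff ℝ n fun L => M L i j) :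
    ContDiff ℝ n fun L => (M L).det := by
  simp only [Matrix.det_apply]
  exact ContDiff.sum fun σ _ => (contDiff_prod fun i _ => hM _ _).const_smul _

theorem contDiff_entry (i j : Y) {n : ℕ∞} : ContDiff ℝ n fun L : Matrix Y Y ℝ => L i j :=
  (LinearMap.toContinuousLinearMap (Matrix.entryLinearMap ℝ ℝ i j)).contDiff

theorem contDiff_minor (A : Finset Y) {n : ℕ∞} :
    ContDiff ℝ n fun L : Matrix Y Y ℝ => minor L A :=
  contDiff_det_comp fun _ _ => contDiff_entry _ _

theorem contDiff_det_add_one {n : ℕ∞} : ContDiff ℝ n fun L : Matrix Y Y ℝ => (L + 1).det :=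
  contDiff_det_comp fun i j => (contDiff_entry i j).add contDiff_const

theorem contDiffAt_log_prob {A : Finset Y} {L : Matrix Y Y ℝ} (hA : minor L A ≠ 0)
    (hL : (L + 1).det ≠ 0) {n : ℕ∞} : ContDiffAt ℝ n (fun X => Real.log (prob X A)) L :=
  ((contDiff_minor A).contDiffAt.div contDiff_det_add_one.contDiffAt hL).log (div_ne_zero hA hL)

end Frobenius

theorem det_add_one_ne_zero {L : Matrix Y Y ℝ} (hL : L.PosSemidef) : (L + 1).det ≠ 0 :=
  (Matrix.PosDef.posSemidef_add hL Matrix.PosDef.one).det_pos.ne'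

/-! ### Objective and minibatch objective as weighted sums of log-probabilities. -/

open Classical in
/-- The sets that occur as positive or negative samples. -/
noncomputable def sampleSets (pos : Multiset (Finset Y)) (ν : PMF (Finset Y)) : Finset (Finset Y) :=
  Finset.univ.filter fun A => A ∈ pos ∨ A ∈ ν.support

theorem mem_sampleSets {pos : Multiset (Finset Y)} {ν : PMF (Finset Y)} {A : Finset Y} :
    A ∈ sampleSets pos ν ↔ A ∈ pos ∨ A ∈ ν.support := by
  simp [sampleSets]

/-- The weight of `log P_L(A)` in the objective. -/
noncomputable def weight (pos : Multiset (Finset Y)) (ν : PMF (Finset Y)) (A : Finset Y) : ℝ :=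
  (pos.count A : ℝ) / Multiset.card pos - (ν A).toReal

/-- The weight of `log P_L(A)` in the objective of a minibatch. -/
noncomputable def batchWeight {p q : ℕ} (b : (Fin p → Finset Y) × (Fin q → Finset Y))
    (A : Finset Y) : ℝ :=
  (∑ j, if b.1 j = A then (1 : ℝ) else 0) / p - (∑ j, if b.2 j = A then (1 : ℝ) else 0) / q

/-- The positive frequencies sum to one, so the term log det(L + 1) is absorbed into the
log-probabilities. The minibatch objective has the same form with random weights. -/
theorem phiCE_eq_sum {pos : Multiset (Finset Y)} (hpos : pos ≠ 0) {ν : PMF (Finset Y)}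
    {L : Matrix Y Y ℝ} (hL : (L + 1).det ≠ 0) (h : ∀ A ∈ sampleSets pos ν, minor L A ≠ 0) :
    phiCE pos ν L = ∑ A ∈ sampleSets pos ν, weight pos ν A * Real.log (prob L A) := by
  have hcard : (Multiset.card pos : ℝ) ≠ 0 := by simpa using hpos
  have h1 : (pos.map fun A => Real.log (minor L A)) =
      pos.map fun A => Real.log (prob L A) + Real.log (L + 1).det := by
    refine Multiset.map_congr rfl fun A hA => ?_
    rw [prob, Real.log_div (h A (mem_sampleSets.2 (Or.inl hA))) hL, sub_add_cancel]
  have h2 : (pos.map fun A => Real.log (prob L A)).sum =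
      ∑ A ∈ sampleSets pos ν, (pos.count A : ℝ) * Real.log (prob L A) := by
    rw [Finset.sum_multiset_map_count]
    simp only [nsmul_eq_mul]
    refine Finset.sum_subset (fun A hA => mem_sampleSets.2 (Or.inl (Multiset.mem_toFinset.1 hA)))
      fun A _ hA => ?_
    rw [Multiset.count_eq_zero.2 (by simpa using hA), Nat.cast_zero, zero_mul]
  have h3 : ∑ A : Finset Y, (ν A).toReal * Real.log (prob L A) =
      ∑ A ∈ sampleSets pos ν, (ν A).toReal * Real.log (prob L A) := by
    refine (Finset.sum_subset (Finset.subset_univ _) fun A _ hA => ?_).symm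
    have : ν A = 0 := by
      by_contra h0
      exact hA (mem_sampleSets.2 (Or.inr ((PMF.mem_support_iff ν A).2 h0)))
    rw [this, ENNReal.toReal_zero, zero_mul]
  rw [phiCE, phiMLE, h1, Multiset.sum_map_add, h2, h3, Multiset.map_const', Multiset.sum_replicate,
    nsmul_eq_mul, add_div, mul_div_cancel_left₀ _ hcard, add_sub_cancel_right, Finset.sum_div,
    ← Finset.sum_sub_distrib]
  refine Finset.sum_congr rfl fun A _ => ?_
  rw [weight]
  ring

theorem sum_comp_eq_sum_indicator {m : ℕ} (S : Finset (Finset Y)) (b : Fin m → Finset Y)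
    (hb : ∀ j, b j ∈ S) (h : Finset Y → ℝ) :
    ∑ j, h (b j) = ∑ A ∈ S, (∑ j, if b j = A then (1 : ℝ) else 0) * h A := by
  simp only [Finset.sum_mul]
  rw [Finset.sum_comm]
  refine Finset.sum_congr rfl fun j _ => ?_
  simp [hb j]

theorem phiBatch_eq_sum {p q : ℕ} {b : (Fin p → Finset Y) × (Fin q → Finset Y)}
    {S : Finset (Finset Y)} (h1 : ∀ j, b.1 j ∈ S) (h2 : ∀ j, b.2 j ∈ S) :
    phiBatch b = fun L => ∑ A ∈ S, batchWeight b A * Real.log (prob L A) := by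
  ext L
  rw [phiBatch, sum_comp_eq_sum_indicator S b.1 h1 fun A => Real.log (prob L A),
    sum_comp_eq_sum_indicator S b.2 h2 fun A => Real.log (prob L A), Finset.sum_div, Finset.sum_div,
    ← Finset.sum_sub_distrib]
  refine Finset.sum_congr rfl fun A _ => ?_
  rw [batchWeight]
  ring

namespace IsProjectedSGA

variable {Ω : Type*} [mΩ : MeasurableSpace Ω] {μ : Measure Ω}
  {ℱ : Filtration ℕ mΩ} {pos : Multiset (Finset Y)} {hpos : pos ≠ 0} {ν : PMF (Finset Y)}
  {K : Set (Matrix Y Y ℝ)} {η : ℕ → ℝ} {p q : ℕ}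
  {batch : ℕ → Ω → (Fin p → Finset Y) × (Fin q → Finset Y)} {L : ℕ → Ω → Matrix Y Y ℝ}

theorem mem (hL : IsProjectedSGA μ ℱ pos hpos ν K η batch L) (t : ℕ) (ω : Ω) : L t ω ∈ K := by
  cases t with
  | zero => exact hL.init ω
  | succ t => exact (hL.step t ω).1

/-- Discards the null event of a sample whose minor might vanish on `K`, where its logarithm and
gradient are not controlled. -/
theorem ae_mem_sampleSets (hL : IsProjectedSGA μ ℱ pos hpos ν K η batch L) :
    ∀ᵐ ω ∂μ, ∀ t, (∀ j, (batch t ω).1 j ∈ sampleSets pos ν) ∧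
      ∀ j, (batch t ω).2 j ∈ sampleSets pos ν := by
  rw [ae_all_iff]
  intro t
  have h1 : ∀ᵐ ω ∂μ, ∀ j, ∀ A ∉ sampleSets pos ν, (batch t ω).1 j ≠ A := by
    refine ae_all_iff.2 fun j => ae_all_iff.2 fun A => ?_
    by_cases hA : A ∈ sampleSets pos ν
    · exact Eventually.of_forall fun ω h => absurd hA h
    · have h0 := hL.law_pos t j A
      rw [PMF.ofMultiset_apply_of_notMem hpos fun h => hA (mem_sampleSets.2 (Or.inl h))] at h0
      exact (measure_eq_zero_iff_ae_notMem.1 h0).mono fun ω h _ => h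
  have h2 : ∀ᵐ ω ∂μ, ∀ j, ∀ A ∉ sampleSets pos ν, (batch t ω).2 j ≠ A := by
    refine ae_all_iff.2 fun j => ae_all_iff.2 fun A => ?_
    by_cases hA : A ∈ sampleSets pos ν
    · exact Eventually.of_forall fun ω h => absurd hA h
    · have h0 := hL.law_neg t j A
      rw [(PMF.apply_eq_zero_iff ν A).2 fun h => hA (mem_sampleSets.2 (Or.inr h))] at h0
      exact (measure_eq_zero_iff_ae_notMem.1 h0).mono fun ω h _ => h
  filter_upwards [h1, h2] with ω h1 h2
  exact ⟨fun j => by_contra fun h => h1 j _ h rfl, fun j => by_contra fun h => h2 j _ h rfl⟩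

theorem stronglyMeasurable_batchWeight (t : ℕ) (A : Finset Y) :
    StronglyMeasurable[MeasurableSpace.comap (batch t) ⊤] fun ω => batchWeight (batch t ω) A := by
  have h : Measurable[⊤] fun b : (Fin p → Finset Y) × (Fin q → Finset Y) => batchWeight b A :=
    fun _ _ => trivial
  exact (h.comp (comap_measurable (batch t))).stronglyMeasurable

/-- Unbiasedness. By linearity of expectation only the law of each single sample matters, not their
joint law within the batch. -/
theorem integral_batchWeight [IsProbabilityMeasure μ]
    (hL : IsProjectedSGA μ ℱ pos hpos ν K η batch L) (hp : 0 < p)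
    (hq : 0 < q) (t : ℕ) (A : Finset Y) :
    ∫ ω, batchWeight (batch t ω) A ∂μ = weight pos ν A := by
  have hset : ∀ s : Set ((Fin p → Finset Y) × (Fin q → Finset Y)),
      MeasurableSet {ω | batch t ω ∈ s} := fun s =>
    ℱ.le (t + 1) _ (hL.batch_measurable t (MeasurableSpace.measurableSet_top (s := s)))
  have hm1 : ∀ j, MeasurableSet {ω | (batch t ω).1 j = A} := fun j => hset {b | b.1 j = A}
  have hm2 : ∀ j, MeasurableSet {ω | (batch t ω).2 j = A} := fun j => hset {b | b.2 j = A}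
  have e1 : ∀ j, (fun ω => if (batch t ω).1 j = A then (1 : ℝ) else 0) =
      {ω | (batch t ω).1 j = A}.indicator 1 := fun j => by
    ext ω; simp [Set.indicator_apply]
  have e2 : ∀ j, (fun ω => if (batch t ω).2 j = A then (1 : ℝ) else 0) =
      {ω | (batch t ω).2 j = A}.indicator 1 := fun j => by
    ext ω; simp [Set.indicator_apply]
  have i1 : ∀ j, Integrable (fun ω => if (batch t ω).1 j = A then (1 : ℝ) else 0) μ := fun j => by
    rw [e1]; exact (integrable_const (1 : ℝ)).indicator (hm1 j)
  have i2 : ∀ j, Integrable (fun ω => if (batch t ω).2 j = A then (1 : ℝ) else 0) μ := fun j => by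
    rw [e2]; exact (integrable_const (1 : ℝ)).indicator (hm2 j)
  have v1 : ∀ j, ∫ ω, (if (batch t ω).1 j = A then (1 : ℝ) else 0) ∂μ =
      (pos.count A : ℝ) / Multiset.card pos := fun j => by
    rw [e1, integral_indicator_one (hm1 j), measureReal_def, hL.law_pos, PMF.ofMultiset_apply,
      ENNReal.toReal_div]
    simp only [ENNReal.toReal_natCast]
    congr!
  have v2 : ∀ j, ∫ ω, (if (batch t ω).2 j = A then (1 : ℝ) else 0) ∂μ = (ν A).toReal := fun j => by
    rw [e2, integral_indicator_one (hm2 j), measureReal_def, hL.law_neg]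
  have hp' : (p : ℝ) ≠ 0 := by positivity
  have hq' : (q : ℝ) ≠ 0 := by positivity
  simp only [batchWeight]
  rw [integral_sub ((integrable_finsetSum _ fun j _ => i1 j).div_const _)
      ((integrable_finsetSum _ fun j _ => i2 j).div_const _), integral_div, integral_div,
    integral_finsetSum _ fun j _ => i1 j, integral_finsetSum _ fun j _ => i2 j]
  simp only [v1, v2, Finset.sum_const, Finset.card_univ, Fintype.card_fin, nsmul_eq_mul]
  rw [mul_div_cancel_left₀ _ hp', mul_div_cancel_left₀ _ hq', weight]

end IsProjectedSGA

end DPP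

/-! ### Criticality of limit points and the conclusion for the contrastive objective. -/

/-- The derivative is nonpositive in tangent directions at a point that is maximal up to a quadratic
error. -/
theorem fderiv_nonpos_of_quadratic_bound {E : Type*} [NormedAddCommGroup E]
    [InnerProductSpace ℝ E] {f : E → ℝ} {K : Set E} {x v : E} {a : ℝ} (hf : DifferentiableAt ℝ f x)
    (h : ∀ w ∈ K, f w ≤ f x + a * ‖w - x‖ ^ 2) (hv : v ∈ tangentConeAt ℝ≥0 K x) :
    fderiv ℝ f x v ≤ 0 := by
  -- The quadratic penalty has zero derivative at `x`, so subtracting it makes `x` a maximum on `K`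
  -- without changing the first-order condition.
  have h1 : HasFDerivAt (fun w => f w - a * ‖w - x‖ ^ 2) (fderiv ℝ f x) x := by
    have := hf.hasFDerivAt.sub ((((hasFDerivAt_id x).sub_const x).norm_sq).const_mul a)
    refine this.congr_fderiv ?_
    ext u
    simp
  have h2 : IsLocalMaxOn (fun w => f w - a * ‖w - x‖ ^ 2) K x :=
    IsMaxOn.localize fun w hw => by
      have := h w hw
      simp only [Set.mem_ofPred_eq, sub_self, norm_zero]
      linarith
  exact h2.hasFDerivWithinAt_nonpos h1.hasFDerivWithinAt hv

namespace DPP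

variable {Y : Type*} [Fintype Y] [DecidableEq Y]

section Frobenius

attribute [local instance] Matrix.frobeniusNormedAddCommGroup Matrix.frobeniusNormedSpace
  frobeniusInnerProductSpace

/-- The determinants stay nonzero in a neighbourhood of `X`, so the weighted-sum formula holds there
and may be differentiated. -/
theorem contDiffAt_phiCE {pos : Multiset (Finset Y)} (hpos : pos ≠ 0) {ν : PMF (Finset Y)}
    {X : Matrix Y Y ℝ} (hdet : (X + 1).det ≠ 0)
    (hminor : ∀ A ∈ sampleSets pos ν, minor X A ≠ 0) :
    ContDiffAt ℝ 2 (phiCE pos ν) X ∧ grad (phiCE pos ν) X =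
      ∑ A ∈ sampleSets pos ν, weight pos ν A • grad (fun Z => Real.log (prob Z A)) X := by
  have hev : phiCE pos ν =ᶠ[𝓝 X]
      fun Z => ∑ A ∈ sampleSets pos ν, weight pos ν A * Real.log (prob Z A) := by
    have h1 : ∀ᶠ Z in 𝓝 X, (Z + 1).det ≠ 0 :=
      (contDiff_det_add_one (n := 2)).continuous.continuousAt.eventually_ne hdet
    have h2 : ∀ᶠ Z in 𝓝 X, ∀ A ∈ sampleSets pos ν, minor Z A ≠ 0 :=
      (Filter.eventually_all_finset _).2 fun A hA =>
        (contDiff_minor A (n := 2)).continuous.continuousAt.eventually_ne (hminor A hA)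
    filter_upwards [h1, h2] with Z h1 h2
    exact phiCE_eq_sum hpos h1 h2
  have hlog : ∀ A ∈ sampleSets pos ν, ContDiffAt ℝ 2 (fun Z => Real.log (prob Z A)) X :=
    fun A hA => contDiffAt_log_prob (n := 2) (hminor A hA) hdet
  have hcd : ContDiffAt ℝ 2 (phiCE pos ν) X :=
    (ContDiffAt.sum fun A hA => contDiffAt_const.mul (hlog A hA)).congr_of_eventuallyEq hev
  have hd : ∀ A ∈ sampleSets pos ν, DifferentiableAt ℝ (fun Z => Real.log (prob Z A)) X :=
    fun A hA => (hlog A hA).differentiableAt (by simp)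
  refine ⟨hcd, ?_⟩
  rw [← grad_sum_mul _ hd]
  ext i j
  rw [grad_apply (hcd.differentiableAt (by simp)), hev.fderiv_eq,
    grad_apply (DifferentiableAt.fun_sum fun A hA => (hd A hA).const_mul _)]

theorem isCriticalOn_of_quadratic_bound {f : Matrix Y Y ℝ → ℝ} {K : Set (Matrix Y Y ℝ)}
    {X : Matrix Y Y ℝ} (hX : X ∈ K) (hf : DifferentiableAt ℝ f X) {a : ℝ}
    (h : ∀ W ∈ K, f W ≤ f X + a * ‖W - X‖ ^ 2) : IsCriticalOn f K X := by
  refine ⟨hX, fun V hV => ?_⟩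
  exact (inner_grad hf V).trans_le (fderiv_nonpos_of_quadratic_bound hf h hV)

theorem IsProjectedSGA.ae_tendsto {Ω : Type*} [mΩ : MeasurableSpace Ω] {μ : Measure Ω}
    [IsProbabilityMeasure μ] {ℱ : Filtration ℕ mΩ} {pos : Multiset (Finset Y)} {hpos : pos ≠ 0}
    {ν : PMF (Finset Y)} {K : Set (Matrix Y Y ℝ)} {η : ℕ → ℝ} {p q : ℕ}
    {batch : ℕ → Ω → (Fin p → Finset Y) × (Fin q → Finset Y)} {L : ℕ → Ω → Matrix Y Y ℝ}
    (hL : IsProjectedSGA μ ℱ pos hpos ν K η batch L) (hK : IsCompact K)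
    (hproj : ProjectionWellDefinedNear K) (hdet : ∀ X ∈ K, (X + 1).det ≠ 0)
    (hminor : ∀ X ∈ K, ∀ A ∈ sampleSets pos ν, minor X A ≠ 0) (hη : ∀ t, 0 < η t)
    (hηsum : ¬ Summable η) (hηsq : Summable fun t => η t ^ 2) (hp : 0 < p) (hq : 0 < q) :
    ∀ᵐ ω ∂μ, (∃ c : ℝ, Tendsto (fun t => phiCE pos ν (L t ω)) atTop (𝓝 c) ∧
        ∀ X ∈ limitPoints (fun t => L t ω),
          IsCriticalOn (phiCE pos ν) K X ∧ phiCE pos ν X = c) ∧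
      IsCompact (limitPoints fun t => L t ω) ∧ IsConnected (limitPoints fun t => L t ω) ∧
      Tendsto (fun t => L t ω) atTop (𝓝ˢ (limitPoints fun t => L t ω)) := by
  let _ : MeasurableSpace (Matrix Y Y ℝ) := MeasurableSpace.pi
  have _ : BorelSpace (Matrix Y Y ℝ) := inferInstanceAs (BorelSpace (Y → Y → ℝ))
  -- The product topology and the topology of the Frobenius norm agree, but each presentation needs
  -- its own Borel instance.
  have _ : @BorelSpace (Matrix Y Y ℝ) PseudoMetricSpace.toUniformSpace.toTopologicalSpace _ :=
    inferInstanceAs (BorelSpace (Y → Y → ℝ))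
  have _ : ProperSpace (Matrix Y Y ℝ) := FiniteDimensional.proper_real _
  obtain ⟨r, hr0, hr⟩ := hproj
  simp only [frobNorm_eq_norm, isNearest_iff] at hr
  set S := sampleSets pos ν with hS
  have hcd : ∀ X ∈ K, ContDiffAt ℝ 2 (phiCE pos ν) X := fun X hX =>
    (contDiffAt_phiCE hpos (hdet X hX) (hminor X hX)).1
  have hgrad : ∀ X ∈ K, grad (phiCE pos ν) X =
      ∑ A ∈ S, weight pos ν A • grad (fun Z => Real.log (prob Z A)) X := fun X hX =>
    (contDiffAt_phiCE hpos (hdet X hX) (hminor X hX)).2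
  have hlog : ∀ A ∈ S, ∀ X ∈ K, ContDiffAt ℝ 2 (fun Z => Real.log (prob Z A)) X :=
    fun A hA X hX => contDiffAt_log_prob (n := 2) (hminor X hX A hA) (hdet X hX)
  have hcont : ∀ A ∈ S, ContinuousOn (grad fun Z => Real.log (prob Z A)) K := fun A hA =>
    continuousOn_grad (hlog A hA)
  obtain ⟨l, hl⟩ := hK.exists_quadratic_bound hcd
  -- the stochastic gradients
  have hbatch : ∀ᵐ ω ∂μ, ∀ t, grad (phiBatch (batch t ω)) (L t ω) =
      ∑ A ∈ S, batchWeight (batch t ω) A • grad (fun Z => Real.log (prob Z A)) (L t ω) := by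
    filter_upwards [hL.ae_mem_sampleSets] with ω hω t
    rw [phiBatch_eq_sum (hω t).1 (hω t).2]
    exact grad_sum_mul _ fun A hA => (hlog A hA _ (hL.mem t ω)).differentiableAt (by simp)
  choose! b hb using fun A (hA : A ∈ S) => hK.exists_bound_of_continuousOn (hcont A hA)
  have hN : ∀ A : Finset Y, ∃ n : ℝ, ∀ u : (Fin p → Finset Y) × (Fin q → Finset Y),
      |batchWeight u A| ≤ n := fun A => by
    obtain ⟨n, hn⟩ := (Set.finite_range fun u : (Fin p → Finset Y) × (Fin q → Finset Y) =>
      |batchWeight u A|).bddAbove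
    exact ⟨n, fun u => hn ⟨u, rfl⟩⟩
  choose N hN using hN
  have hGB : ∀ᵐ ω ∂μ, ∀ t, ‖grad (phiBatch (batch t ω)) (L t ω)‖ ≤ ∑ A ∈ S, N A * b A := by
    filter_upwards [hbatch] with ω hω t
    rw [hω]
    refine norm_sum_le_of_le S fun A hA => ?_
    rw [norm_smul, Real.norm_eq_abs]
    exact mul_le_mul (hN A _) (hb A hA _ (hL.mem t ω)) (norm_nonneg _)
      ((abs_nonneg _).trans (hN A (batch t ω)))
  have hLmeas : ∀ t, Measurable[ℱ t] (L t) := fun t =>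
    @measurable_pi_lambda _ _ _ (ℱ t) _ _ fun i =>
      @measurable_pi_lambda _ _ _ (ℱ t) _ _ fun j => hL.adapted t i j
  have hinner : ∀ t, ∀ W ∈ K,
      Integrable (fun ω => inner ℝ (grad (phiBatch (batch t ω)) (L t ω)) (L t ω - W)) μ ∧
      μ[fun ω => inner ℝ (grad (phiBatch (batch t ω)) (L t ω)) (L t ω - W) | ℱ t] =ᵐ[μ]
        fun ω => inner ℝ (grad (phiCE pos ν) (L t ω)) (L t ω - W) := by
    intro t W hW
    have hHc : ∀ A ∈ S, ContinuousOn
        (fun X => inner ℝ (grad (fun Z => Real.log (prob Z A)) X) (X - W)) K := fun A hA =>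
      (hcont A hA).inner (continuousOn_id.sub continuousOn_const)
    choose! c hc using fun A (hA : A ∈ S) => hK.exists_bound_of_continuousOn (hHc A hA)
    have hcomap : MeasurableSpace.comap (batch t) ⊤ ≤ mΩ :=
      (hL.batch_measurable t).comap_le.trans (ℱ.le (t + 1))
    obtain ⟨hI, hE⟩ := integrable_and_condExp_sum_mul_of_indep hcomap (ℱ.le t) (hL.batch_indep t)
      S (N := fun A ω => batchWeight (batch t ω) A)
      (H := fun A ω => inner ℝ (grad (fun Z => Real.log (prob Z A)) (L t ω)) (L t ω - W))
      (fun A _ => stronglyMeasurable_batchWeight t A)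
      (fun A hA => by
        have h1 : Measurable[ℱ t] fun ω => (⟨L t ω, hL.mem t ω⟩ : K) := (hLmeas t).subtype_mk
        exact ((continuousOn_iff_continuous_domRestrict.1 (hHc A hA)).measurable.comp
          h1).stronglyMeasurable)
      (fun A _ ω => hN A _) (fun A hA ω => hc A hA _ (hL.mem t ω))
    have hae : (fun ω => inner ℝ (grad (phiBatch (batch t ω)) (L t ω)) (L t ω - W)) =ᵐ[μ]
        fun ω => ∑ A ∈ S, batchWeight (batch t ω) A *
          inner ℝ (grad (fun Z => Real.log (prob Z A)) (L t ω)) (L t ω - W) := by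
      filter_upwards [hbatch] with ω hω
      rw [hω, sum_inner]
      exact Finset.sum_congr rfl fun A _ => real_inner_smul_left _ _ _
    refine ⟨hI.congr hae.symm, ?_⟩
    filter_upwards [condExp_congr_ae (m := ℱ t) hae, hE] with ω h1 h2
    rw [h1, h2, hgrad _ (hL.mem t ω), sum_inner]
    refine Finset.sum_congr rfl fun A _ => ?_
    rw [hL.integral_batchWeight hp hq, real_inner_smul_left]
  obtain ⟨a, ha⟩ := ae_tendsto_projected_stochastic_ascent (μ := μ) (ℱ := ℱ) hK hr0 hr
    (f := phiCE pos ν) (g := grad (phiCE pos ν))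
    (fun X hX => (hcd X hX).continuousAt.continuousWithinAt) (continuousOn_grad hcd)
    (fun X hX W hW => by
      rw [inner_grad ((hcd X hX).differentiableAt (by simp))]
      exact hl X hX W hW)
    hη hηsum hηsq hL.mem hLmeas hGB (fun t W hW => (hinner t W hW).1)
    (fun t W hW => (hinner t W hW).2) (fun t ω => isNearest_iff.1 (hL.step t ω))
  filter_upwards [ha] with ω ⟨hdist, c, hc, hlim⟩
  refine ⟨⟨c, hc, fun X hX => ?_⟩, hK.isCompact_mapClusterPt fun t => hL.mem t ω,
    hK.isConnected_mapClusterPt (fun t => hL.mem t ω) hdist,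
    hK.tendsto_nhdsSet_mapClusterPt fun t => hL.mem t ω⟩
  obtain ⟨hXK, hXc, hXq⟩ := hlim X hX
  exact ⟨isCriticalOn_of_quadratic_bound hXK ((hcd X hXK).differentiableAt (by simp)) hXq, hXc⟩

end Frobenius

end DPP

theorem mainTheorem1
    {Y : Type*} [Fintype Y] [DecidableEq Y]
    -- the training set of positive samples and the static negative distribution
    (pos : Multiset (Finset Y)) (hpos : pos ≠ 0) (ν : PMF (Finset Y))
    (k : ℕ) (hk : 0 < k) (hkcard : ∀ A : Finset Y, (A ∈ pos ∨ A ∈ ν.support) → A.card ≤ k)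
    -- the closed and bounded set of positive semidefinite matrices of rank (at most) `k`
    (K : Set (Matrix Y Y ℝ)) (hKcompact : IsCompact K)
    (hKpsd : ∀ L ∈ K, L.PosSemidef) (hKrank : ∀ L ∈ K, L.rank ≤ k)
    (hKproj : DPP.ProjectionWellDefinedNear K)
    -- the objective is defined on `K`: all logarithms in it are finite
    (hKdef : ∀ L ∈ K, ∀ A : Finset Y, (A ∈ pos ∨ A ∈ ν.support) → DPP.minor L A ≠ 0)
    -- the step sizes
    (η : ℕ → ℝ) (hη : ∀ t, 0 < η t) (hηsum : ¬ Summable η)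
    (hηsq : Summable fun t => η t ^ 2)
    -- the run of projected stochastic gradient ascent
    {Ω : Type*} [mΩ : MeasurableSpace Ω] (μ : Measure Ω) [IsProbabilityMeasure μ]
    (ℱ : Filtration ℕ mΩ)
    (p q : ℕ) (hp : 0 < p) (hq : 0 < q)
    (batch : ℕ → Ω → (Fin p → Finset Y) × (Fin q → Finset Y))
    (L : ℕ → Ω → Matrix Y Y ℝ)
    (hL : DPP.IsProjectedSGA μ ℱ pos hpos ν K η batch L) :
    ∀ᵐ ω ∂μ,
      -- the objective converges, and every limit point is a critical point of the limiting value
      (∃ c : ℝ, Tendsto (fun t => DPP.phiCE pos ν (L t ω)) atTop (𝓝 c) ∧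
        ∀ X ∈ DPP.limitPoints (fun t => L t ω),
          DPP.IsCriticalOn (DPP.phiCE pos ν) K X ∧ DPP.phiCE pos ν X = c) ∧
      -- the iterates converge to the set of limit points, which is compact and connected
      IsCompact (DPP.limitPoints fun t => L t ω) ∧
      IsConnected (DPP.limitPoints fun t => L t ω) ∧
      Tendsto (fun t => L t ω) atTop (𝓝ˢ (DPP.limitPoints fun t => L t ω)) ∧
      -- and to a single critical point if the critical points of equal value form no continuum
      ((∀ c : ℝ, IsTotallyDisconnected
          {X | DPP.IsCriticalOn (DPP.phiCE pos ν) K X ∧ DPP.phiCE pos ν X = c}) →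
        ∃ X, DPP.IsCriticalOn (DPP.phiCE pos ν) K X ∧
          Tendsto (fun t => L t ω) atTop (𝓝 X)) := by
  have hdet : ∀ X ∈ K, (X + 1).det ≠ 0 := fun X hX => DPP.det_add_one_ne_zero (hKpsd X hX)
  have hminor : ∀ X ∈ K, ∀ A ∈ DPP.sampleSets pos ν, DPP.minor X A ≠ 0 := fun X hX A hA =>
    hKdef X hX A (DPP.mem_sampleSets.1 hA)
  filter_upwards [hL.ae_tendsto hKcompact hKproj hdet hminor hη hηsum hηsq hp hq]
    with ω ⟨⟨c, hc, hcrit⟩, hcomp, hconn, hnhds⟩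
  refine ⟨⟨c, hc, hcrit⟩, hcomp, hconn, hnhds, fun htd => ?_⟩
  -- A connected set inside a totally disconnected one is a single point, and converging to the set
  -- then means converging to that point.
  have hsub := htd c _ hcrit hconn.isPreconnected
  obtain ⟨X, hX⟩ := hconn.nonempty
  refine ⟨X, (hcrit X hX).1, ?_⟩
  rwa [hsub.eq_singleton_of_mem hX, nhdsSet_singleton] at hnhds
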